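/- Let $n\ge 0$ be an integer and $k=\lceil n/2\rceil$. The Aztec diamond of order $n$ is the region made of the unit squares $[x,x+1]\times[y,y+1]$, $x,y\in\mathbb Z$, with $|x+\tfrac12|+|y+\tfrac12|\le n$; equivalently, it is the symmetric stack of $2n$ rows of unit squares of lengths $2,4,\dots,2n-2,2n,2n,2n-2,\dots,4,2$. The line of slope $1$ through its center runs diagonally through exactly $2k$ of its squares (the spine); number them $1,2,\dots,2k$ from southwest to northeast. A barrier is an edge of the square grid that no domino is permitted to cross. At every even-numbered square of the spine place either a zig (barriers on the bottom and right edges of the square) or a zag (barriers on the left and top edges of the square), chosen arbitrarily and independently for each such square; at the odd-numbered squares place no barriers. A domino is a $1\times 2$ or $2\times 1$ rectangle consisting of two unit squares that share an edge, and a domino tiling is compatible with the barriers if none of its dominoes crosses a barrier. Then, whatever the choice of zigs and zags, the number of domino tilings of the Aztec diamond of order $n$ that are compatible with the barriers is $$\frac{2^{n(n+1)/2}}{2^{k}}.$$ -/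

import Mathlib

namespace Aztec

/-- The unit square `[x, x+1] × [y, y+1]` of the square grid is named by its lower left
corner `(x, y)`; `x` grows to the right and `y` grows upwards. -/
abbrev Square : Type := ℤ × ℤ

/-- The Aztec diamond of order `n`, centred at the origin: the unit squares whose centre
`(x + 1/2, y + 1/2)` satisfies `|x + 1/2| + |y + 1/2| ≤ n`. -/
def diamond (n : ℕ) : Set Square :=
  {p | |2 * p.1 + 1| + |2 * p.2 + 1| ≤ 2 * (n : ℤ)}

/-- The rows of the diamond: for `0 ≤ j < n`, the `j`-th row above the horizontal axis and the
`j`-th row below it both consist of the `2 * (n - j)` squares with `-(n-j) ≤ x < n-j`. -/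
theorem mem_diamond_row (n : ℕ) (x j : ℤ) (hj : 0 ≤ j) :
    ((x, j) ∈ diamond n ↔ -(n - j) ≤ x ∧ x < n - j) ∧
      ((x, -1 - j) ∈ diamond n ↔ -(n - j) ≤ x ∧ x < n - j) := by
  simp only [diamond, Set.mem_ofPred_eq]
  constructor <;> constructor <;> intro h <;>
    rcases abs_cases (2 * x + 1) with h1 | h1 <;>
    rcases abs_cases (2 * j + 1) with h2 | h2 <;>
    rcases abs_cases (2 * (-1 - j) + 1) with h3 | h3 <;> omega

/-- The four sides of a unit square. -/
inductive Side
  | left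
  | right
  | top
  | bottom

/-- The square that shares the given side with `p`. -/
def neighbor (p : Square) : Side → Square
  | Side.left => (p.1 - 1, p.2)
  | Side.right => (p.1 + 1, p.2)
  | Side.top => (p.1, p.2 + 1)
  | Side.bottom => (p.1, p.2 - 1)

/-- A domino is a 1-by-2 or 2-by-1 rectangle: two unit squares that share an edge. -/
def IsDomino (D : Finset Square) : Prop :=
  ∃ (p : Square) (s : Side), D = {p, neighbor p s}

/-- `T` is a domino tiling of the region `R`: its members are dominoes contained in `R`, and
every square of `R` belongs to exactly one of them. -/
def IsTiling (R : Set Square) (T : Finset (Finset Square)) : Prop :=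
  (∀ D ∈ T, IsDomino D ∧ (D : Set Square) ⊆ R) ∧
    ∀ p ∈ R, ∃! D : Finset Square, D ∈ T ∧ p ∈ D

/-- A domino crosses the edge that is side `s` of the square `p` if it consists of the two
squares on either side of this edge. -/
def Crosses (D : Finset Square) (p : Square) (s : Side) : Prop :=
  D = {p, neighbor p s}

/-- A tiling is compatible with a set of barriers (edges, given as sides of squares) if no
domino of the tiling crosses a barrier. -/
def Compatible (T : Finset (Finset Square)) (barriers : Set (Square × Side)) : Prop :=
  ∀ D ∈ T, ∀ e ∈ barriers, ¬ Crosses D e.1 e.2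

/-- The possible decisions at a square of the spine. -/
inductive Decision
  | zip
  | zig
  | zag

/-- The sides of a square that carry a barrier: none for `zip`, the bottom and right sides for
`zig`, the left and top sides for `zag`. -/
def Decision.sides : Decision → Set Side
  | Decision.zip => ∅
  | Decision.zig => {Side.bottom, Side.right}
  | Decision.zag => {Side.left, Side.top}

/-- The `i`-th square of a spine of `2 * k` squares, numbered from `1` to `2 * k` from
southwest to northeast along the line of slope 1 through the origin. -/
def spineSquare (k i : ℕ) : Square := ((i : ℤ) - 1 - k, (i : ℤ) - 1 - k)

/-- With `k = ⌈n/2⌉`, the squares `1, …, 2k` of the spine are exactly the squares of the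
Aztec diamond of order `n` that lie on the diagonal. -/
theorem image_spineSquare (n : ℕ) :
    spineSquare ⌈(n : ℚ) / 2⌉₊ '' Set.Icc 1 (2 * ⌈(n : ℚ) / 2⌉₊) =
      {p | p ∈ diamond n ∧ p.1 = p.2} := by
  have hk : ⌈(n : ℚ) / 2⌉₊ = (n + 1) / 2 := by
    have h := Nat.div_add_mod (n + 1) 2
    have h2 := Nat.mod_lt (n + 1) two_pos
    generalize (n + 1) / 2 = m at *
    apply le_antisymm
    · have : n ≤ 2 * m := by omega
      have : (n : ℚ) ≤ 2 * m := by exact_mod_cast this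
      exact Nat.ceil_le.2 (by linarith)
    · by_contra! hlt
      have h3 : (n : ℚ) ≤ 2 * (⌈(n : ℚ) / 2⌉₊ : ℚ) := by linarith [Nat.le_ceil ((n : ℚ) / 2)]
      have h4 : n ≤ 2 * ⌈(n : ℚ) / 2⌉₊ := by exact_mod_cast h3
      omega
  rw [hk]
  ext ⟨x, y⟩
  simp only [diamond, spineSquare, Set.mem_image, Set.mem_Icc, Set.mem_ofPred_eq, Prod.mk.injEq]
  constructor
  · rintro ⟨i, hi, rfl, rfl⟩
    refine ⟨?_, rfl⟩
    rcases abs_cases (2 * ((i : ℤ) - 1 - ((n + 1) / 2 : ℕ)) + 1) with h1 | h1 <;> omega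
  · rintro ⟨h, rfl⟩
    refine ⟨(x + 1 + ((n + 1) / 2 : ℕ)).toNat, ?_⟩
    rcases abs_cases (2 * x + 1) with h1 | h1 <;> omega

/-- The barriers that result from the decisions `d 1, …, d (2 * k)` at the squares
`1, …, 2 * k` of the spine. -/
def barriers (k : ℕ) (d : ℕ → Decision) : Set (Square × Side) :=
  {e | ∃ i ∈ Finset.Icc 1 (2 * k), e.1 = spineSquare k i ∧ e.2 ∈ (d i).sides}

end Aztec

/-! The squares with the colour of the spine ("black") form `2k + 1` diagonal rows of `2k` squares,
separated by `2k` rows of white squares; for odd `n` the two extreme black rows are fictitious. For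
each black row record the set of columns whose domino goes up, that is, to the left or to the top.
Tilings are then counted by products of transfer coefficients between consecutive sets. A zig or zag
at an even-numbered spine square says exactly that its column (odd, since columns start at `0`) does
or does not belong to the set `A` of the spine row.

Attach to a set of columns the wedge product of the polynomials `(1 + X) ^ a`, with `a` in the set.
Summing these wedges against the transfer coefficients amounts to contracting with evaluation at `0`
and then applying the map induced by `lower` (`descent_wedge_of_recursion`). Hence each half of the
diamond contributes, up to a power of two, the `weight` of `A` or of its complement, and the number
of tilings is a power of two times the sum `S` of `weight A * weight Aᶜ` over all `A` with
prescribed odd elements.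

To evaluate `S`, pass to the exterior algebra of `M × M`, where `doubleForm` is a signed product of
two flag forms. Take the wedge of the vectors `(ψ j, ψ j)` for even `j`, and of `(ψ j, 0)` or `(0, ψ
j)` for odd `j` according to the decision. Expanding it gives `± S`. The shear `(x, y) ↦ (x, y - x)`
preserves the form and leaves a single term, in which evens and odds are separated; up to sign this
does not depend on the decisions (`sum_flagForm_mul_flagForm_compl_sq`). Its two factors follow from
a recursion (`flagForm_wedge_sq`). Since `S` is nonnegative, being a count up to a positive factor,
its square determines it. -/

namespace ExteriorAlgebra

/-! ### Contractions and the alternating forms they generate. -/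

variable {M N : Type*} [AddCommGroup M] [Module ℚ M] [AddCommGroup N] [Module ℚ N]

theorem ι_mul_induction {P : ExteriorAlgebra ℚ M → Prop}
    (scalar : ∀ r : ℚ, P (algebraMap ℚ _ r)) (add : ∀ x y, P x → P y → P (x + y))
    (ι_mul : ∀ x m, P x → P (ι ℚ m * x)) (x : ExteriorAlgebra ℚ M) : P x :=
  CliffordAlgebra.left_induction (Q := (0 : QuadraticForm ℚ M)) scalar add ι_mul x

/-- Contraction of the exterior algebra with a linear functional, an antiderivation. -/
noncomputable def contract (d : Module.Dual ℚ M) : ExteriorAlgebra ℚ M →ₗ[ℚ] ExteriorAlgebra ℚ M :=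
  CliffordAlgebra.contractLeft (Q := (0 : QuadraticForm ℚ M)) d

theorem contract_ι_mul (d : Module.Dual ℚ M) (v : M) (x : ExteriorAlgebra ℚ M) :
    contract d (ι ℚ v * x) = d v • x - ι ℚ v * contract d x :=
  CliffordAlgebra.contractLeft_ι_mul (Q := (0 : QuadraticForm ℚ M)) d v x

theorem contract_algebraMap (d : Module.Dual ℚ M) (r : ℚ) :
    contract d (algebraMap ℚ (ExteriorAlgebra ℚ M) r) = 0 :=
  CliffordAlgebra.contractLeft_algebraMap (Q := (0 : QuadraticForm ℚ M)) d r

theorem contract_one (d : Module.Dual ℚ M) : contract d (1 : ExteriorAlgebra ℚ M) = 0 :=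
  CliffordAlgebra.contractLeft_one (Q := (0 : QuadraticForm ℚ M)) d

theorem contract_contract (d : Module.Dual ℚ M) (x : ExteriorAlgebra ℚ M) :
    contract d (contract d x) = 0 :=
  CliffordAlgebra.contractLeft_contractLeft (Q := (0 : QuadraticForm ℚ M)) d x

theorem contract_sub (d d' : Module.Dual ℚ M) (x : ExteriorAlgebra ℚ M) :
    contract (d - d') x = contract d x - contract d' x := by
  simp only [contract, map_sub, LinearMap.sub_apply]

theorem contract_smul (c : ℚ) (d : Module.Dual ℚ M) (x : ExteriorAlgebra ℚ M) :
    contract (c • d) x = c • contract d x := by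
  simp only [contract, map_smul, LinearMap.smul_apply]

theorem contract_zero (x : ExteriorAlgebra ℚ M) : contract (0 : Module.Dual ℚ M) x = 0 := by
  simp only [contract, map_zero, LinearMap.zero_apply]

theorem contract_map (f : M →ₗ[ℚ] N) (d : Module.Dual ℚ N) (x : ExteriorAlgebra ℚ M) :
    contract d (map f x) = map f (contract (d ∘ₗ f) x) := by
  induction x using ι_mul_induction with
  | scalar r => rw [AlgHom.commutes, contract_algebraMap, contract_algebraMap, map_zero]
  | add x y hx hy => simp only [map_add, hx, hy]
  | ι_mul x m hx =>
    simp only [map_mul, map_apply_ι, contract_ι_mul, hx, map_sub, map_smul, LinearMap.comp_apply]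

theorem map_map (f : M →ₗ[ℚ] N) {K : Type*} [AddCommGroup K] [Module ℚ K] (g : N →ₗ[ℚ] K)
    (x : ExteriorAlgebra ℚ M) : map g (map f x) = map (g ∘ₗ f) x := by
  rw [← map_comp_map, AlgHom.comp_apply]

theorem algebraMapInv_map (f : M →ₗ[ℚ] N) (x : ExteriorAlgebra ℚ M) :
    algebraMapInv (map f x) = algebraMapInv x := by
  induction x using ι_mul_induction with
  | scalar r => simp
  | add x y hx hy => simp only [map_add, hx, hy]
  | ι_mul x m hx => simp [algebraMapInv]

/-- Graded Leibniz rule: `-LinearMap.id` induces the grading involution, which supplies the sign for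
passing the contraction over `x`. -/
theorem contract_mul (d : Module.Dual ℚ M) (x y : ExteriorAlgebra ℚ M) :
    contract d (x * y) = contract d x * y + map (-LinearMap.id) x * contract d y := by
  induction x using ι_mul_induction with
  | scalar r =>
    rw [contract_algebraMap, AlgHom.commutes, ← Algebra.smul_def, ← Algebra.smul_def, map_smul,
      zero_mul, zero_add]
  | add x x' hx hy => simp only [map_add, add_mul, hx, hy]; abel
  | ι_mul x m hx =>
    rw [mul_assoc, contract_ι_mul, contract_ι_mul, hx, map_mul, map_apply_ι]
    simp only [LinearMap.neg_apply, LinearMap.id_apply, map_neg, neg_mul, sub_mul, mul_add,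
      smul_mul_assoc, mul_assoc]
    abel

theorem ι_mul_comm (v w : M) : ι ℚ v * ι ℚ w = -(ι ℚ w * ι ℚ v) :=
  eq_neg_of_add_eq_zero_left (ι_add_mul_swap v w)

theorem ι_mul_eq_map_neg_mul (v : M) (x : ExteriorAlgebra ℚ M) :
    ι ℚ v * x = map (-LinearMap.id) x * ι ℚ v := by
  induction x using ι_mul_induction with
  | scalar r => rw [AlgHom.commutes, Algebra.commutes]
  | add x y hx hy => simp only [map_add, add_mul, mul_add, hx, hy]
  | ι_mul x m hx =>
    rw [← mul_assoc, ι_mul_comm, map_mul, map_apply_ι, neg_mul, mul_assoc, hx]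
    simp [mul_assoc]

/-- Contraction with `d`, followed by the endomorphism induced by `s`. -/
noncomputable def descent (d : Module.Dual ℚ M) (s : M →ₗ[ℚ] M) :
    ExteriorAlgebra ℚ M →ₗ[ℚ] ExteriorAlgebra ℚ M :=
  (map s).toLinearMap ∘ₗ contract d

theorem descent_apply (d : Module.Dual ℚ M) (s : M →ₗ[ℚ] M) (x : ExteriorAlgebra ℚ M) :
    descent d s x = map s (contract d x) := rfl

/-- The alternating form of degree `i` obtained from the functionals `d, d ∘ s, d ∘ s ∘ s, …`. -/
noncomputable def flagForm (d : Module.Dual ℚ M) (s : M →ₗ[ℚ] M) :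
    ℕ → ExteriorAlgebra ℚ M →ₗ[ℚ] ℚ
  | 0 => algebraMapInv.toLinearMap
  | i + 1 => flagForm d s i ∘ₗ descent d s

theorem flagForm_zero (d : Module.Dual ℚ M) (s : M →ₗ[ℚ] M) (x : ExteriorAlgebra ℚ M) :
    flagForm d s 0 x = algebraMapInv x := rfl

theorem flagForm_succ (d : Module.Dual ℚ M) (s : M →ₗ[ℚ] M) (i : ℕ) (x : ExteriorAlgebra ℚ M) :
    flagForm d s (i + 1) x = flagForm d s i (descent d s x) := rfl

/-- Each of the `i` contractions consumes one vector and so releases one factor `c`. This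
homogeneity stands in for a grading. -/
theorem flagForm_map_smul (d : Module.Dual ℚ M) (s : M →ₗ[ℚ] M) (c : ℚ) (i : ℕ)
    (x : ExteriorAlgebra ℚ M) :
    flagForm d s i (map (c • LinearMap.id) x) = c ^ i * flagForm d s i x := by
  induction i generalizing x with
  | zero => simp [flagForm_zero, algebraMapInv_map]
  | succ i ih =>
    have h : descent d s (map (c • LinearMap.id) x) =
        c • map (c • LinearMap.id) (descent d s x) := by
      rw [descent_apply, contract_map, map_map, descent_apply, map_map, ← map_smul,
        ← contract_smul]
      have e1 : d ∘ₗ (c • LinearMap.id) = c • d := by ext; simp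
      have e2 : s ∘ₗ (c • LinearMap.id) = (c • LinearMap.id) ∘ₗ s := by ext; simp
      rw [e1, e2]
    rw [flagForm_succ, h, map_smul, ih, flagForm_succ, smul_eq_mul, pow_succ]
    ring

open Classical in
/-- The product of the vectors `ψ j` over the `j < m` with `j ∈ S`, in decreasing order. -/
noncomputable def wedge (ψ : ℕ → M) (S : Set ℕ) : ℕ → ExteriorAlgebra ℚ M
  | 0 => 1
  | m + 1 => (if m ∈ S then ι ℚ (ψ m) else 1) * wedge ψ S m

theorem wedge_succ_of_mem {ψ : ℕ → M} {S : Set ℕ} {m : ℕ} (h : m ∈ S) :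
    wedge ψ S (m + 1) = ι ℚ (ψ m) * wedge ψ S m := by
  rw [wedge, if_pos h]

theorem wedge_succ_of_notMem {ψ : ℕ → M} {S : Set ℕ} {m : ℕ} (h : m ∉ S) :
    wedge ψ S (m + 1) = wedge ψ S m := by
  rw [wedge, if_neg h, one_mul]

theorem wedge_congr {ψ : ℕ → M} {S S' : Set ℕ} {m : ℕ} (h : ∀ j < m, j ∈ S ↔ j ∈ S') :
    wedge ψ S m = wedge ψ S' m := by
  induction m with
  | zero => rfl
  | succ m ih =>
    have hm := h m (Nat.lt_succ_self m)
    have ih' := ih fun j hj => h j (hj.trans (Nat.lt_succ_self m))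
    by_cases hS : m ∈ S
    · rw [wedge_succ_of_mem hS, wedge_succ_of_mem (hm.1 hS), ih']
    · rw [wedge_succ_of_notMem hS, wedge_succ_of_notMem (fun h' => hS (hm.2 h')), ih']

theorem map_smul_wedge (c : ℚ) (ψ : ℕ → M) (A : Finset ℕ) {m : ℕ} (hA : A ⊆ Finset.range m) :
    map (c • LinearMap.id) (wedge ψ A m) = c ^ A.card • wedge ψ A m := by
  induction m generalizing A with
  | zero => simp [wedge, Finset.subset_empty.1 hA]
  | succ m ih =>
    have key := ih (A.erase m) (by
      intro j hj
      have h1 := Finset.mem_erase.1 hj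
      have := Finset.mem_range.1 (hA h1.2)
      exact Finset.mem_range.2 (by omega))
    rw [wedge_congr (S' := (A : Set ℕ)) (by
      intro j hj
      simp [hj.ne])] at key
    by_cases h : m ∈ A
    · rw [wedge_succ_of_mem (by exact_mod_cast h), map_mul, key, map_apply_ι,
        ← Finset.card_erase_add_one h, pow_succ]
      simp [smul_smul, mul_comm]
    · rw [Finset.erase_eq_of_notMem h] at key
      rw [wedge_succ_of_notMem (by exact_mod_cast h), key]

/-- Scaling all vectors by `2` multiplies the value both by `2 ^ A.card` and by `2 ^ i`. -/
theorem flagForm_wedge_eq_zero (d : Module.Dual ℚ M) (s : M →ₗ[ℚ] M) (ψ : ℕ → M) {A : Finset ℕ}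
    {m i : ℕ} (hA : A ⊆ Finset.range m) (hi : A.card ≠ i) : flagForm d s i (wedge ψ A m) = 0 := by
  have h := flagForm_map_smul d s 2 i (wedge ψ A m)
  rw [map_smul_wedge 2 ψ A hA, map_smul, smul_eq_mul] at h
  by_contra h0
  exact hi (Nat.pow_right_injective le_rfl
    (by exact_mod_cast mul_right_cancel₀ h0 h : (2 : ℕ) ^ A.card = 2 ^ i))

/-- Two sequences obeying the column-by-column recursion of an interlacing sum are determined by
the descent of a wedge. -/
theorem descent_wedge_of_recursion (d : Module.Dual ℚ M) (s : M →ₗ[ℚ] M) (ψ : ℕ → M)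
    (hd : ∀ m, d (ψ m) = 1) (hs : ∀ m, s (ψ (m + 1)) + ψ (m + 1) = s (ψ m) - ψ m)
    (A : Set ℕ) (w₀ w₁ : ℚ) (hw : w₀ * w₁ = 2) (S₀ S₁ : ℕ → ExteriorAlgebra ℚ M)
    (h₀ : S₀ 0 = 0) (h₁ : S₁ 0 = 1) (N : ℕ)
    (hmem : ∀ m < N, m ∈ A → S₀ (m + 1) = ι ℚ (ψ m) * S₀ m + w₁ • S₁ m ∧
      S₁ (m + 1) = ι ℚ (ψ m) * S₁ m)
    (hnot : ∀ m < N, m ∉ A → S₀ (m + 1) = S₀ m ∧ S₁ (m + 1) = S₁ m + w₀ • (ι ℚ (ψ m) * S₀ m)) :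
    S₀ N = w₁ • descent d s (wedge ψ A N) ∧
      S₁ N = map s (wedge ψ A N) - ι ℚ (s (ψ N) + ψ N) * descent d s (wedge ψ A N) := by
  -- The formula for `S₁` is the invariant that closes the induction: by `hs`, its correction vector
  -- `s (ψ N) + ψ N` turns into `s (ψ m) - ψ m` when `N = m + 1`. For `m ∈ A` the discrepancy
  -- vanishes because repeated vectors square to zero.
  induction N with
  | zero => simp [wedge, descent_apply, contract_one, h₀, h₁]
  | succ m ih =>
    obtain ⟨i₀, i₁⟩ := ih (fun j hj => hmem j (by omega)) (fun j hj => hnot j (by omega))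
    by_cases h : m ∈ A
    · obtain ⟨e₀, e₁⟩ := hmem m (Nat.lt_succ_self m) h
      have hK : descent d s (ι ℚ (ψ m) * wedge ψ A m) =
          map s (wedge ψ A m) - ι ℚ (s (ψ m)) * descent d s (wedge ψ A m) := by
        rw [descent_apply, contract_ι_mul, hd, one_smul, map_sub, map_mul, map_apply_ι,
          ← descent_apply]
      rw [e₀, e₁, i₀, i₁, wedge_succ_of_mem h, hs, hK, map_mul, map_apply_ι]
      set K := descent d s (wedge ψ A m)
      set E := map s (wedge ψ A m)
      have q1 : ι ℚ (s (ψ m)) * (ι ℚ (s (ψ m)) * K) = 0 := by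
        rw [← mul_assoc, ι_sq_zero, zero_mul]
      have q2 : ι ℚ (ψ m) * (ι ℚ (ψ m) * K) = 0 := by
        rw [← mul_assoc, ι_sq_zero, zero_mul]
      constructor
      · simp only [map_add, add_mul, smul_sub, mul_smul_comm, smul_add]
        abel
      · simp only [map_add, map_sub, add_mul, sub_mul, mul_sub, mul_add, q1, q2]
        abel
    · obtain ⟨e₀, e₁⟩ := hnot m (Nat.lt_succ_self m) h
      rw [e₀, e₁, i₀, i₁, wedge_succ_of_notMem h, hs]
      refine ⟨rfl, ?_⟩
      -- Here `w₀ * w₁ = 2` is needed: the added term `2 ψ m` is the difference between `s (ψ m) + ψ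
      -- m` and `s (ψ m) - ψ m`.
      rw [mul_smul_comm, smul_smul, hw, two_smul]
      simp only [map_add, map_sub, add_mul, sub_mul]
      abel

/-! ### Two copies of the flag form on `M × M`. -/

section Doubling

variable (d : Module.Dual ℚ M) (s : M →ₗ[ℚ] M)

/-- The alternating form of degree `2 * i` on `M × M` built from two copies of `flagForm`. -/
noncomputable def doubleForm : ℕ → ExteriorAlgebra ℚ (M × M) →ₗ[ℚ] ℚ
  | 0 => algebraMapInv.toLinearMap
  | i + 1 => doubleForm i ∘ₗ (map (s.prodMap s)).toLinearMap ∘ₗ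
      contract (d ∘ₗ LinearMap.snd ℚ M M) ∘ₗ contract (d ∘ₗ LinearMap.fst ℚ M M)

theorem doubleForm_succ (i : ℕ) (x : ExteriorAlgebra ℚ (M × M)) :
    doubleForm d s (i + 1) x = doubleForm d s i (map (s.prodMap s)
      (contract (d ∘ₗ LinearMap.snd ℚ M M) (contract (d ∘ₗ LinearMap.fst ℚ M M) x))) := rfl

/-- Under the shear `d ∘ snd` becomes `d ∘ snd - d ∘ fst`, and the extra contraction with `d ∘ fst`
vanishes because it follows another one. The shear also commutes with `s.prodMap s`. -/
theorem doubleForm_map_shear (i : ℕ) (x : ExteriorAlgebra ℚ (M × M)) :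
    doubleForm d s i (map ((LinearMap.fst ℚ M M).prod
      (LinearMap.snd ℚ M M - LinearMap.fst ℚ M M)) x) = doubleForm d s i x := by
  induction i generalizing x with
  | zero => exact algebraMapInv_map _ _
  | succ i ih =>
    have e1 : (d ∘ₗ LinearMap.fst ℚ M M) ∘ₗ ((LinearMap.fst ℚ M M).prod
      (LinearMap.snd ℚ M M - LinearMap.fst ℚ M M)) = d ∘ₗ LinearMap.fst ℚ M M := by
      ext <;> simp
    have e2 : (d ∘ₗ LinearMap.snd ℚ M M) ∘ₗ ((LinearMap.fst ℚ M M).prod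
      (LinearMap.snd ℚ M M - LinearMap.fst ℚ M M)) =
        d ∘ₗ LinearMap.snd ℚ M M - d ∘ₗ LinearMap.fst ℚ M M := by
      ext <;> simp
    have e3 : s.prodMap s ∘ₗ ((LinearMap.fst ℚ M M).prod
      (LinearMap.snd ℚ M M - LinearMap.fst ℚ M M)) = ((LinearMap.fst ℚ M M).prod
      (LinearMap.snd ℚ M M - LinearMap.fst ℚ M M)) ∘ₗ s.prodMap s := by
      ext <;> simp
    rw [doubleForm_succ, contract_map, contract_map, e1, e2, contract_sub, contract_contract,
      sub_zero, map_map, e3, ← map_map, ih, doubleForm_succ]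

/-- Each contraction sees only one of the two factors. Passing the second one over the contracted
first factor applies the grading involution there, which the remaining form of degree `i` reads as
the sign `(-1) ^ i`. Only the square of the accumulated sign matters later. -/
theorem exists_doubleForm_mul (i : ℕ) : ∃ c : ℚ, c ^ 2 = 1 ∧ ∀ x y : ExteriorAlgebra ℚ M,
    doubleForm d s i (map (LinearMap.inl ℚ M M) x * map (LinearMap.inr ℚ M M) y) =
      c * (flagForm d s i x * flagForm d s i y) := by
  induction i with
  | zero =>
    refine ⟨1, by norm_num, fun x y => ?_⟩
    change algebraMapInv _ = _
    rw [map_mul, algebraMapInv_map, algebraMapInv_map, one_mul]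
    rfl
  | succ i ih =>
    obtain ⟨c, hc, h⟩ := ih
    refine ⟨c * (-1) ^ i, by rw [mul_pow, hc, ← pow_mul, mul_comm i, pow_mul]; norm_num,
      fun x y => ?_⟩
    have z1 : (d ∘ₗ LinearMap.fst ℚ M M) ∘ₗ LinearMap.inr ℚ M M = 0 := by ext; simp
    have z2 : (d ∘ₗ LinearMap.snd ℚ M M) ∘ₗ LinearMap.inl ℚ M M = 0 := by ext; simp
    have z3 : (d ∘ₗ LinearMap.fst ℚ M M) ∘ₗ LinearMap.inl ℚ M M = d := by ext; simp
    have z4 : (d ∘ₗ LinearMap.snd ℚ M M) ∘ₗ LinearMap.inr ℚ M M = d := by ext; simp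
    have z5 : s.prodMap s ∘ₗ LinearMap.inr ℚ M M = LinearMap.inr ℚ M M ∘ₗ s := by
      ext <;> simp
    have z6 : s.prodMap s ∘ₗ (-LinearMap.id) ∘ₗ LinearMap.inl ℚ M M =
        LinearMap.inl ℚ M M ∘ₗ ((-1 : ℚ) • LinearMap.id) ∘ₗ s := by
      ext <;> simp
    rw [doubleForm_succ, contract_mul, contract_map _ _ y, z1, contract_zero, map_zero, mul_zero,
      add_zero, contract_map, z3, contract_mul, contract_map, z2, contract_zero, map_zero, zero_mul,
      zero_add, contract_map, z4, map_mul, map_map, map_map, map_map, LinearMap.comp_assoc, z5]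
    rw [z6, ← map_map, ← map_map, ← map_map, h, flagForm_map_smul, flagForm_succ, flagForm_succ,
      descent_apply, descent_apply]
    ring

end Doubling

end ExteriorAlgebra

/-! ### Expanding a wedge in `M × M` in two ways. -/

namespace ExteriorAlgebra

variable {M : Type*} [AddCommGroup M] [Module ℚ M]

/-- The sign of the shuffle that moves the `j < m` with `j ∈ A` behind the other ones. -/
def shuffleSign (A : Finset ℕ) : ℕ → ℚ
  | 0 => 1
  | m + 1 => if m ∈ A then shuffleSign A m
      else (-1) ^ (A ∩ Finset.range m).card * shuffleSign A m

theorem shuffleSign_sq (A : Finset ℕ) (m : ℕ) : shuffleSign A m ^ 2 = 1 := by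
  induction m with
  | zero => simp [shuffleSign]
  | succ m ih =>
    rw [shuffleSign]
    split_ifs
    · exact ih
    · rw [mul_pow, ih, ← pow_mul, mul_comm _ 2, pow_mul]
      norm_num

theorem shuffleSign_congr {A B : Finset ℕ} {m : ℕ} (h : ∀ j < m, j ∈ A ↔ j ∈ B) :
    shuffleSign A m = shuffleSign B m := by
  induction m with
  | zero => rfl
  | succ m ih =>
    have e : A ∩ Finset.range m = B ∩ Finset.range m := by
      ext j
      simp only [Finset.mem_inter, Finset.mem_range]
      constructor
      · rintro ⟨h1, h2⟩
        exact ⟨(h j (by omega)).1 h1, h2⟩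
      · rintro ⟨h1, h2⟩
        exact ⟨(h j (by omega)).2 h1, h2⟩
    simp only [shuffleSign, h m (Nat.lt_succ_self m), e, ih fun j hj => h j (by omega)]

/-- Multilinear expansion: `A` is the set of indices at which the first coordinate is chosen. A
second-coordinate vector `ψ m`, entering on the left, must pass the `A ∩ range m` vectors of the
first copy, hence the shuffle sign. -/
theorem wedge_prod_eq_sum (ψ : ℕ → M) (α β : ℕ → ℚ) (m : ℕ) :
    wedge (fun j => (α j • ψ j, β j • ψ j)) Set.univ m =
      ∑ A ∈ (Finset.range m).powerset,
        (shuffleSign A m * ∏ j ∈ Finset.range m, if j ∈ A then α j else β j) •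
          (map (LinearMap.inl ℚ M M) (wedge ψ A m) *
            map (LinearMap.inr ℚ M M) (wedge ψ (A : Set ℕ)ᶜ m)) := by
  induction m with
  | zero => simp [wedge, shuffleSign]
  | succ m ih =>
    rw [wedge_succ_of_mem (Set.mem_univ m), ih, Finset.range_add_one,
      Finset.sum_powerset_insert Finset.notMem_range_self, Finset.mul_sum, ← Finset.sum_add_distrib]
    refine Finset.sum_congr rfl fun A hA => ?_
    rw [Finset.mem_powerset] at hA
    have hm : m ∉ A := fun h => Finset.notMem_range_self (hA h)
    have e1 : wedge ψ ((insert m A : Finset ℕ) : Set ℕ) m = wedge ψ A m :=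
      wedge_congr fun j hj => by simp [hj.ne]
    have e2 : wedge ψ ((insert m A : Finset ℕ) : Set ℕ)ᶜ m = wedge ψ (A : Set ℕ)ᶜ m :=
      wedge_congr fun j hj => by simp [hj.ne]
    have e3 : shuffleSign (insert m A) m = shuffleSign A m :=
      shuffleSign_congr fun j hj => by simp [hj.ne]
    have e4 : (∏ j ∈ Finset.range m, if j ∈ insert m A then α j else β j) =
        ∏ j ∈ Finset.range m, if j ∈ A then α j else β j :=
      Finset.prod_congr rfl fun j hj => by simp [(Finset.mem_range.1 hj).ne]
    have s1 : shuffleSign (insert m A) (m + 1) = shuffleSign A m := by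
      rw [shuffleSign, if_pos (Finset.mem_insert_self m A), e3]
    have s2 : shuffleSign A (m + 1) = (-1) ^ A.card * shuffleSign A m := by
      rw [shuffleSign, if_neg hm, Finset.inter_eq_left.2 hA]
    have e5 : (α m • ψ m, β m • ψ m) = α m • LinearMap.inl ℚ M M (ψ m) +
        β m • LinearMap.inr ℚ M M (ψ m) := by simp
    rw [wedge_succ_of_mem (S := ((insert m A : Finset ℕ) : Set ℕ)) (by simp),
      wedge_succ_of_notMem (S := ((insert m A : Finset ℕ) : Set ℕ)ᶜ) (by simp),
      wedge_succ_of_notMem (S := (A : Set ℕ)) (by simpa using hm),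
      wedge_succ_of_mem (S := (A : Set ℕ)ᶜ) (by simpa using hm), e1, e2,
      s1, s2, Finset.prod_insert Finset.notMem_range_self, if_neg hm,
      Finset.prod_insert Finset.notMem_range_self, if_pos (Finset.mem_insert_self m A), e4, e5]
    set X := wedge ψ (A : Set ℕ) m
    have hcomm : ι ℚ (LinearMap.inr ℚ M M (ψ m)) * map (LinearMap.inl ℚ M M) X =
        (-1 : ℚ) ^ A.card • (map (LinearMap.inl ℚ M M) X * ι ℚ (LinearMap.inr ℚ M M (ψ m))) := by
      have := map_smul_wedge (-1) ψ A hA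
      have e6 : (-LinearMap.id : M × M →ₗ[ℚ] M × M) ∘ₗ LinearMap.inl ℚ M M =
          LinearMap.inl ℚ M M ∘ₗ ((-1 : ℚ) • LinearMap.id) := by ext <;> simp
      rw [ι_mul_eq_map_neg_mul, map_map, e6, ← map_map, this, map_smul, smul_mul_assoc]
    rw [map_mul, map_mul, map_apply_ι, map_apply_ι, mul_smul_comm, map_add, map_smul, map_smul,
      add_mul, smul_mul_assoc, smul_mul_assoc, ← mul_assoc, ← mul_assoc, hcomm, smul_mul_assoc,
      smul_add, smul_smul, smul_smul, smul_smul, add_comm,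
      mul_assoc (map (LinearMap.inl ℚ M M) X)]
    congr 2 <;> ring

/-- Reading the indices in pairs `2j, 2j + 1`, one checks the four membership patterns. The point is
that once the odd elements are prescribed, the sign depends only on the cardinality of `A`, so all
terms of the later sum carry the same sign. -/
theorem shuffleSign_two_mul (z : ℕ → Prop) [DecidablePred z] (A : Finset ℕ) (m : ℕ)
    (h : ∀ j < m, 2 * j + 1 ∈ A ↔ z j) :
    shuffleSign A (2 * m) = (∏ i ∈ Finset.range m, if z i then (-1 : ℚ) else 1) *
      ∏ i ∈ Finset.range (A ∩ Finset.range (2 * m)).card, (-1 : ℚ) ^ (i + 1) := by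
  induction m with
  | zero => simp [shuffleSign]
  | succ m ih =>
    have hz := h m (Nat.lt_succ_self m)
    have hcard (j : ℕ) : (A ∩ Finset.range (j + 1)).card =
        (A ∩ Finset.range j).card + if j ∈ A then 1 else 0 := by
      rw [Finset.range_add_one]
      split_ifs with hj
      · rw [Finset.inter_insert_of_mem hj, Finset.card_insert_of_notMem (by simp)]
      · rw [Finset.inter_insert_of_notMem hj, add_zero]
    rw [show 2 * (m + 1) = 2 * m + 1 + 1 by ring, shuffleSign, shuffleSign,
      ih fun j hj => h j (by omega), Finset.prod_range_succ _ m, hcard (2 * m + 1), hcard (2 * m)]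
    set a := (A ∩ Finset.range (2 * m)).card
    have hsq : ((-1 : ℚ) ^ a) * (-1) ^ a = 1 := by rw [← mul_pow]; norm_num
    by_cases h0 : 2 * m ∈ A <;> by_cases h1 : z m
    · simp only [h0, hz, h1, if_true, Finset.prod_range_succ, pow_succ]
      linear_combination (-(∏ i ∈ Finset.range m, if z i then (-1 : ℚ) else 1) *
        ∏ i ∈ Finset.range a, (-1 : ℚ) ^ i * -1) * hsq
    · simp only [h0, hz, h1, if_true, if_false, add_zero, Finset.prod_range_succ, pow_succ]
      ring
    · simp only [h0, hz, h1, if_true, if_false, add_zero, Finset.prod_range_succ, pow_succ]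
      ring
    · simp only [h0, hz, h1, if_false, add_zero, mul_one]
      linear_combination ((∏ i ∈ Finset.range m, if z i then (-1 : ℚ) else 1) *
        ∏ i ∈ Finset.range a, (-1 : ℚ) ^ (i + 1)) * hsq

theorem map_wedge {N : Type*} [AddCommGroup N] [Module ℚ N] (f : M →ₗ[ℚ] N) (ψ : ℕ → M)
    (S : Set ℕ) (m : ℕ) : map f (wedge ψ S m) = wedge (fun j => f (ψ j)) S m := by
  induction m with
  | zero => simp [wedge]
  | succ m ih =>
    by_cases h : m ∈ S
    · rw [wedge_succ_of_mem h, wedge_succ_of_mem h, map_mul, map_apply_ι, ih]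
    · rw [wedge_succ_of_notMem h, wedge_succ_of_notMem h, ih]

/-- The wedge is unchanged when every vector but `f 0` is replaced by its difference from the
preceding one. As `d` kills the differences, the contraction just removes `f 0`. -/
theorem contract_wedge_univ (d : Module.Dual ℚ M) (f : ℕ → M) (c : ℚ) (h : ∀ i, d (f i) = c)
    (k : ℕ) : contract d (wedge f Set.univ (k + 1)) =
      ((-1) ^ k * c) • wedge (fun i => f (i + 1) - f i) Set.univ k := by
  induction k with
  | zero =>
    rw [wedge_succ_of_mem (Set.mem_univ 0), contract_ι_mul, h]
    simp [wedge, contract_one]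
  | succ k ih =>
    have e : wedge f Set.univ (k + 1 + 1) =
        ι ℚ (f (k + 1) - f k) * wedge f Set.univ (k + 1) := by
      rw [wedge_succ_of_mem (Set.mem_univ _), map_sub, sub_mul,
        wedge_succ_of_mem (m := k) (Set.mem_univ _), ← mul_assoc (ι ℚ (f k)), ι_sq_zero, zero_mul,
        sub_zero]
    rw [e, contract_ι_mul, ih, map_sub, h, h, sub_self, zero_smul, zero_sub,
      wedge_succ_of_mem (m := k) (Set.mem_univ _), mul_smul_comm, pow_succ, ← neg_smul]
    congr 1
    ring

theorem wedge_even (ψ : ℕ → M) (k : ℕ) :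
    wedge ψ {j | Even j} (2 * k) = wedge (fun i => ψ (2 * i)) Set.univ k := by
  induction k with
  | zero => rfl
  | succ k ih =>
    rw [show 2 * (k + 1) = 2 * k + 1 + 1 by ring, wedge_succ_of_notMem (by simp),
      wedge_succ_of_mem (by simp), wedge_succ_of_mem (Set.mem_univ _), ih]

theorem wedge_odd (ψ : ℕ → M) (k : ℕ) :
    wedge ψ {j | Even j}ᶜ (2 * k) = wedge (fun i => ψ (2 * i + 1)) Set.univ k := by
  induction k with
  | zero => rfl
  | succ k ih =>
    rw [show 2 * (k + 1) = 2 * k + 1 + 1 by ring, wedge_succ_of_mem (by simp),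
      wedge_succ_of_notMem (by simp), wedge_succ_of_mem (Set.mem_univ _), ih]

/-- Expanding a product of `2 * k` vectors `ψ j`, each one in a fixed linear combination of the
two copies of `M` if `j` is odd, in two ways. -/
theorem sum_flagForm_mul_flagForm_compl_sq (d : Module.Dual ℚ M) (s : M →ₗ[ℚ] M) (ψ : ℕ → M)
    (z : ℕ → Prop) [DecidablePred z] (k : ℕ) :
    (∑ A ∈ (Finset.range (2 * k)).powerset with ∀ j < k, 2 * j + 1 ∈ A ↔ z j,
      flagForm d s k (wedge ψ A (2 * k)) *
        flagForm d s k (wedge ψ (A : Set ℕ)ᶜ (2 * k))) ^ 2 =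
      (flagForm d s k (wedge (fun i => ψ (2 * i)) Set.univ k) *
        flagForm d s k (wedge (fun i => ψ (2 * i + 1)) Set.univ k)) ^ 2 := by
  obtain ⟨c, hc, hmul⟩ := exists_doubleForm_mul d s k
  have expand (α β : ℕ → ℚ) :
      doubleForm d s k (wedge (fun j => (α j • ψ j, β j • ψ j)) Set.univ (2 * k)) =
        ∑ A ∈ (Finset.range (2 * k)).powerset,
          (shuffleSign A (2 * k) * ∏ j ∈ Finset.range (2 * k), if j ∈ A then α j else β j) *
            (c * (flagForm d s k (wedge ψ A (2 * k)) *
              flagForm d s k (wedge ψ (A : Set ℕ)ᶜ (2 * k)))) := by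
    rw [wedge_prod_eq_sum, map_sum]
    simp only [map_smul, hmul, smul_eq_mul]
  -- Even indices leave the choice of copy free; an odd index `2i + 1` is forced into the first copy
  -- if `z i` holds and into the second otherwise.
  set α : ℕ → ℚ := fun j => if Even j then 1 else if z (j / 2) then 1 else 0 with hα
  set β : ℕ → ℚ := fun j => if Even j then 1 else if z (j / 2) then 0 else 1 with hβ
  have shear : doubleForm d s k (wedge (fun j => (α j • ψ j, β j • ψ j)) Set.univ (2 * k)) =
      doubleForm d s k (wedge (fun j => (α j • ψ j, (β j - α j) • ψ j)) Set.univ (2 * k)) := by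
    rw [← doubleForm_map_shear, map_wedge]
    simp [sub_smul]
  -- The shuffle sign common to all surviving `A`, which have `k` elements by homogeneity.
  set σ : ℚ := (∏ i ∈ Finset.range k, if z i then (-1 : ℚ) else 1) *
      ∏ i ∈ Finset.range k, (-1 : ℚ) ^ (i + 1) with hσ
  have hσ2 : σ ^ 2 = 1 := by
    rw [hσ, mul_pow, ← Finset.prod_pow, ← Finset.prod_pow, Finset.prod_eq_one, Finset.prod_eq_one,
      one_mul]
    · intro i _
      rw [← pow_mul, mul_comm, pow_mul]
      norm_num
    · intro i _
      split_ifs <;> norm_num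
  have left : doubleForm d s k (wedge (fun j => (α j • ψ j, β j • ψ j)) Set.univ (2 * k)) =
      σ * c * ∑ A ∈ (Finset.range (2 * k)).powerset with ∀ j < k, 2 * j + 1 ∈ A ↔ z j,
        flagForm d s k (wedge ψ A (2 * k)) *
          flagForm d s k (wedge ψ (A : Set ℕ)ᶜ (2 * k)) := by
    rw [expand, Finset.mul_sum, Finset.sum_filter]
    refine Finset.sum_congr rfl fun A hA => ?_
    rw [Finset.mem_powerset] at hA
    split_ifs with h
    · by_cases hcard : A.card = k
      · have hs := shuffleSign_two_mul z A k h
        rw [Finset.inter_eq_left.2 hA, hcard, ← hσ] at hs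
        have hone : (∏ j ∈ Finset.range (2 * k), if j ∈ A then α j else β j) = 1 := ?_
        · rw [hs, hone, mul_one]
          exact (mul_assoc _ _ _).symm
        refine Finset.prod_eq_one fun j hj => ?_
        have hj := Finset.mem_range.1 hj
        rcases Nat.even_or_odd' j with ⟨i, rfl | rfl⟩
        · simp [hα, hβ]
        · have := h i (by omega)
          have e : (2 * i + 1) / 2 = i := by omega
          by_cases hz : z i
          · simp [hα, this.2 hz, e, hz]
          · simp [hβ, mt this.1 hz, e, hz]
      · rw [flagForm_wedge_eq_zero d s ψ hA hcard]
        ring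
    · push Not at h
      obtain ⟨i, hi, h⟩ := h
      rw [Finset.prod_eq_zero (i := 2 * i + 1) (Finset.mem_range.2 (by omega))]
      · ring
      · have e : (2 * i + 1) / 2 = i := by omega
        rcases h with ⟨h1, h2⟩ | ⟨h1, h2⟩
        · simp [hα, h1, h2, e]
        · simp [hβ, h1, h2, e]
  -- After the shear the coefficients at even indices are `(1, 0)`. A nonzero term therefore needs
  -- `A` to contain all `k` even indices, and having `k` elements it equals `E`.
  set E : Finset ℕ := {j ∈ Finset.range (2 * k) | Even j} with hE
  set κ : ℚ := shuffleSign E (2 * k) *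
    ∏ j ∈ Finset.range (2 * k), if j ∈ E then α j else β j - α j with hκ
  have hκ2 : κ ^ 2 = 1 := by
    rw [hκ, mul_pow, shuffleSign_sq, one_mul, ← Finset.prod_pow]
    refine Finset.prod_eq_one fun j hj => ?_
    by_cases he : Even j
    · simp [hE, hα, Finset.mem_range.1 hj, he]
    · by_cases hz : z (j / 2) <;> simp [hE, hα, hβ, he, hz]
  have e1 : wedge ψ E (2 * k) = wedge (fun i => ψ (2 * i)) Set.univ k := by
    rw [← wedge_even]
    exact wedge_congr fun j hj => by simp [hE, hj]
  have e2 : wedge ψ (E : Set ℕ)ᶜ (2 * k) = wedge (fun i => ψ (2 * i + 1)) Set.univ k := by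
    rw [← wedge_odd]
    exact wedge_congr fun j hj => by simp [hE, hj]
  have hEcard : E.card = k := by
    have : E = (Finset.range k).image (fun i => 2 * i) := by
      ext j
      simp only [hE, Finset.mem_filter, Finset.mem_range, Finset.mem_image]
      constructor
      · rintro ⟨h1, i, rfl⟩
        exact ⟨i, by omega, by omega⟩
      · rintro ⟨i, h1, rfl⟩
        exact ⟨by omega, by simp⟩
    rw [this, Finset.card_image_of_injective _ (fun a b h => by simpa using h), Finset.card_range]
  have right : doubleForm d s k
      (wedge (fun j => (α j • ψ j, (β j - α j) • ψ j)) Set.univ (2 * k)) =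
      κ * c * (flagForm d s k (wedge (fun i => ψ (2 * i)) Set.univ k) *
        flagForm d s k (wedge (fun i => ψ (2 * i + 1)) Set.univ k)) := by
    rw [expand α fun j => β j - α j, Finset.sum_eq_single E]
    · rw [e1, e2]
      ring
    · intro A hA hne
      rw [Finset.mem_powerset] at hA
      by_cases hcard : A.card = k
      · have : ∃ j ∈ E, j ∉ A := by
          by_contra! hsub
          exact hne (Finset.eq_of_subset_of_card_le hsub (by omega)).symm
        obtain ⟨j, hj, hjA⟩ := this
        rw [hE, Finset.mem_filter] at hj
        rw [Finset.prod_eq_zero hj.1]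
        · ring
        · simp [hjA, hα, hβ, hj.2]
      · rw [flagForm_wedge_eq_zero d s ψ hA hcard]
        ring
    · intro h
      exact absurd (Finset.mem_powerset.2 (Finset.filter_subset _ _)) h
  rw [left, right] at shear
  have := congrArg (· ^ 2) shear
  simpa only [mul_pow, hσ2, hκ2, hc, one_mul] using this

end ExteriorAlgebra

/-! ### The polynomial model and the value of the spine sum. -/

namespace Aztec

open Polynomial ExteriorAlgebra

/-- Division of `f - f(0)` by `X`, followed by multiplication with `-(X + 2)`. -/
noncomputable def lower : ℚ[X] →ₗ[ℚ] ℚ[X] where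
  toFun f := -(X + 2) * divX f
  map_add' f g := by rw [divX_add, mul_add]
  map_smul' r f := by
    have h : divX (r • f) = r • divX f := by ext; simp [coeff_divX]
    rw [h, mul_smul_comm, RingHom.id_apply]

theorem X_mul_lower (f : ℚ[X]) : X * lower f = -(X + 2) * (f - C (f.coeff 0)) := by
  have h : lower f = -(X + 2) * divX f := rfl
  rw [h]
  linear_combination (-(X + 2)) * divX_mul_X_add f

/-- The consecutive powers have difference `X * (1 + X) ^ m` and sum `(X + 2) * (1 + X) ^ m`, and
`lower` sends the former to minus the latter. This is the relation `hs` of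
`descent_wedge_of_recursion`. -/
theorem lower_pow_succ (m : ℕ) :
    lower ((1 + X) ^ (m + 1)) + (1 + X) ^ (m + 1) = lower ((1 + X) ^ m) - (1 + X) ^ m := by
  apply mul_left_cancel₀ (X_ne_zero (R := ℚ))
  have h (j : ℕ) : ((1 + X : ℚ[X]) ^ j).coeff 0 = 1 := by simp [coeff_zero_eq_eval_zero]
  rw [mul_add, mul_sub, X_mul_lower, X_mul_lower, h, h, C_1]
  ring

/-- The value of the flag form of degree `i` at the wedge product of the vectors `(1 + X) ^ a` for
`a ∈ S`, `a < N`. Up to a power of two, it counts the tilings of one half of the diamond together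
with the squares of the spine in `S`. -/
noncomputable def weight (N i : ℕ) (S : Set ℕ) : ℚ :=
  flagForm (lcoeff ℚ 0) lower i (wedge (fun m => (1 + X : ℚ[X]) ^ m) S N)

/-- Contraction leaves the differences `(1 + X) ^ (2 * i) * X * (X + 2) * h`, and `lower` turns them
into vectors of the same shape with `-(X + 2) ^ 2 * h` in place of `h`. So each step reproduces the
problem with one vector fewer and `h(0)` multiplied by `-4`; squaring discards the signs. -/
theorem flagForm_wedge_sq (h : ℚ[X]) (k : ℕ) :
    flagForm (lcoeff ℚ 0) lower k
      (wedge (fun i => (1 + X : ℚ[X]) ^ (2 * i) * h) Set.univ k) ^ 2 =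
      (h.coeff 0 ^ 2) ^ k * 4 ^ (k * (k - 1)) := by
  induction k generalizing h with
  | zero => simp [flagForm_zero, wedge]
  | succ k ih =>
    have e : (fun i => lower ((1 + X : ℚ[X]) ^ (2 * (i + 1)) * h - (1 + X) ^ (2 * i) * h)) =
        fun i => (1 + X : ℚ[X]) ^ (2 * i) * (-(X + 2) ^ 2 * h) := by
      ext1 i
      apply mul_left_cancel₀ (X_ne_zero (R := ℚ))
      have h0 : ((1 + X : ℚ[X]) ^ (2 * (i + 1)) * h - (1 + X) ^ (2 * i) * h).coeff 0 = 0 := by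
        simp [coeff_zero_eq_eval_zero]
      rw [X_mul_lower, h0, C_0]
      ring
    have h1 : (-(X + 2) ^ 2 * h : ℚ[X]).coeff 0 = -4 * h.coeff 0 := by
      simp [coeff_zero_eq_eval_zero]
      norm_num
    rw [flagForm_succ, descent_apply, contract_wedge_univ _ _ (h.coeff 0), map_smul, map_wedge, e,
      map_smul, smul_eq_mul, mul_pow, ih, h1]
    · have : ((-1 : ℚ) ^ k) ^ 2 = 1 := by
        rw [← pow_mul, mul_comm, pow_mul]
        norm_num
      rw [mul_pow ((-1 : ℚ) ^ k), this, mul_pow (-4 : ℚ), show (-4 : ℚ) ^ 2 = 4 ^ 2 by norm_num,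
        mul_pow, ← pow_mul 4 2 k]
      cases k with
      | zero => simp
      | succ k =>
        rw [show (k + 1 + 1) * (k + 1 + 1 - 1) = 2 * (k + 1) + (k + 1) * (k + 1 - 1) by
          simp only [Nat.add_sub_cancel]; ring, pow_add 4, pow_succ (h.coeff 0 ^ 2) (k + 1)]
        ring
    · intro i
      simp [coeff_zero_eq_eval_zero]

/-- The even powers correspond to `h = 1` and the odd ones to `h = 1 + X`, both with constant term
`1`. -/
theorem sum_weight_mul_weight_sq (z : ℕ → Prop) [DecidablePred z] (k : ℕ) :
    (∑ A ∈ (Finset.range (2 * k)).powerset with ∀ j < k, 2 * j + 1 ∈ A ↔ z j,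
      weight (2 * k) k A * weight (2 * k) k (A : Set ℕ)ᶜ) ^ 2 = (4 ^ (k * (k - 1))) ^ 2 := by
  simp only [weight]
  rw [sum_flagForm_mul_flagForm_compl_sq, mul_pow]
  have h1 := flagForm_wedge_sq 1 k
  have h2 := flagForm_wedge_sq (1 + X) k
  simp only [mul_one, ← pow_succ] at h1 h2
  rw [h1, h2]
  simp
  ring

end Aztec

/-! ### Covering one row of white squares, scanned column by column. -/

namespace Aztec

open ExteriorAlgebra Polynomial

/-- The number of dominoes that go left from column `m` in a row of white squares: `L` and `L'`
are the columns of the row below and of the row above from which a domino goes left. -/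
def leftCount (L L' : Finset ℕ) (m : ℕ) : ℕ :=
  (if m ∈ L then 1 else 0) + (if m ∈ L' then 1 else 0)

/-- The number of dominoes that go right from column `m` in a row of white squares, when `A` and
`B` are the columns of the row below and of the row above whose dominoes go up. -/
def rightCount (A B L L' : Finset ℕ) (m : ℕ) : ℕ :=
  (if m ∈ A ∧ m ∉ L then 1 else 0) + (if m ∉ B ∧ m ∉ L' then 1 else 0)

/-- The white squares left of column `m` are covered correctly, and the one between the columns
`m - 1` and `m` requires `t` dominoes going left from column `m`. The leftmost white square is to be
covered `ε` times. -/
def Fits (ε : ℕ) (A B L L' : Finset ℕ) : ℕ → ℕ → Prop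
  | 0, t => t = ε
  | m + 1, t => Fits ε A B L L' m (leftCount L L' m) ∧ rightCount A B L L' m + t = 1

theorem fits_congr {ε : ℕ} {A A₁ B B₁ L L₁ L' L₁' : Finset ℕ} {m t : ℕ}
    (hA : ∀ j < m, j ∈ A₁ ↔ j ∈ A) (hB : ∀ j < m, j ∈ B₁ ↔ j ∈ B) (hL : ∀ j < m, j ∈ L₁ ↔ j ∈ L)
    (hL' : ∀ j < m, j ∈ L₁' ↔ j ∈ L') : Fits ε A₁ B₁ L₁ L₁' m t ↔ Fits ε A B L L' m t := by
  induction m generalizing t with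
  | zero => rfl
  | succ m ih =>
    have := Nat.lt_succ_self m
    simp only [Fits, leftCount, rightCount, hA m this, hB m this, hL m this, hL' m this,
      ih (fun j hj => hA j (by omega)) (fun j hj => hB j (by omega)) (fun j hj => hL j (by omega))
        (fun j hj => hL' j (by omega))]

/-- Used with `t = 1 - ε`. If `ε = 1`, the rightmost white square must be covered from the last
column, so nothing remains to be required; if `ε = 0`, that square is missing, and `t = 1` forbids a
domino going right. -/
theorem fits_succ_iff (ε : ℕ) (A B L L' : Finset ℕ) (m t : ℕ) :
    Fits ε A B L L' (m + 1) t ↔ leftCount L L' 0 = ε ∧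
      (∀ i < m, rightCount A B L L' i + leftCount L L' (i + 1) = 1) ∧
        rightCount A B L L' m + t = 1 := by
  induction m generalizing t with
  | zero => simp [Fits]
  | succ m ih =>
    rw [Fits, ih]
    constructor
    · rintro ⟨⟨h1, h2, h3⟩, h4⟩
      refine ⟨h1, fun i hi => ?_, h4⟩
      rcases Nat.lt_succ_iff_lt_or_eq.1 hi with h | rfl
      · exact h2 i h
      · exact h3
    · rintro ⟨h1, h2, h3⟩
      exact ⟨⟨h1, fun i hi => h2 i (by omega), h2 m (by omega)⟩, h3⟩

theorem not_fits_two {ε : ℕ} (hε : ε ≤ 1) (A B L L' : Finset ℕ) (m : ℕ) :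
    ¬ Fits ε A B L L' m 2 := by
  cases m with
  | zero => simp only [Fits]; omega
  | succ m => simp only [Fits]; omega

/-- Reading the row upside down exchanges the two black rows, and dominoes going down become
dominoes going up. -/
theorem fits_compl {ε : ℕ} {A B L L' : Finset ℕ} {N m t : ℕ} (hm : m ≤ N) :
    Fits ε (Finset.range N \ B) (Finset.range N \ A) L' L m t ↔ Fits ε A B L L' m t := by
  induction m generalizing t with
  | zero => rfl
  | succ m ih =>
    have h1 : leftCount L' L m = leftCount L L' m := add_comm _ _
    have h2 : rightCount (Finset.range N \ B) (Finset.range N \ A) L' L m =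
        rightCount A B L L' m := by
      have : m < N := hm
      simp only [rightCount, Finset.mem_sdiff, Finset.mem_range, this, true_and, not_not]
      exact add_comm _ _
    rw [Fits, Fits, ih (by omega), h1, h2]

open Classical in
/-- The indicator of a proposition. -/
noncomputable def ind (p : Prop) : ℚ := if p then 1 else 0

theorem ind_of {p : Prop} (h : p) : ind p = 1 := if_pos h

theorem ind_of_not {p : Prop} (h : ¬ p) : ind p = 0 := if_neg h

/-- The number of ways to choose the dominoes' horizontal directions in the columns `< m` of a row
of white squares. -/
noncomputable def rowCount (ε : ℕ) (A : Finset ℕ) (m t : ℕ) (B : Finset ℕ) : ℚ :=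
  ∑ L ∈ (A ∩ Finset.range m).powerset, ∑ L' ∈ (Finset.range m \ B).powerset,
    ind (Fits ε A B L L' m t)

section Recursion

variable {ε : ℕ} {A B : Finset ℕ} {m : ℕ}

theorem fits_insert_right (L L' : Finset ℕ) (t : ℕ) :
    Fits ε A (insert m B) L L' m t ↔ Fits ε A B L L' m t :=
  fits_congr (fun _ _ => Iff.rfl) (fun j hj => by simp [hj.ne]) (fun _ _ => Iff.rfl)
    (fun _ _ => Iff.rfl)

theorem fits_insert_lower (L L' : Finset ℕ) (t : ℕ) :
    Fits ε A B (insert m L) L' m t ↔ Fits ε A B L L' m t :=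
  fits_congr (fun _ _ => Iff.rfl) (fun _ _ => Iff.rfl) (fun j hj => by simp [hj.ne])
    (fun _ _ => Iff.rfl)

theorem fits_insert_upper (L L' : Finset ℕ) (t : ℕ) :
    Fits ε A B L (insert m L') m t ↔ Fits ε A B L L' m t :=
  fits_congr (fun _ _ => Iff.rfl) (fun _ _ => Iff.rfl) (fun _ _ => Iff.rfl)
    (fun j hj => by simp [hj.ne])

theorem range_succ_sdiff_insert :
    Finset.range (m + 1) \ insert m B = Finset.range m \ B := by
  ext j
  simp only [Finset.mem_sdiff, Finset.mem_range, Finset.mem_insert]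
  constructor
  · rintro ⟨h1, h2⟩
    push Not at h2
    exact ⟨by omega, h2.2⟩
  · rintro ⟨h1, h2⟩
    exact ⟨by omega, by push Not; exact ⟨by omega, h2⟩⟩

theorem range_succ_sdiff (hB : m ∉ B) :
    Finset.range (m + 1) \ B = insert m (Finset.range m \ B) := by
  rw [Finset.range_add_one, Finset.insert_sdiff_of_notMem _ hB]

theorem inter_range_succ_of_mem (hA : m ∈ A) :
    A ∩ Finset.range (m + 1) = insert m (A ∩ Finset.range m) := by
  rw [Finset.range_add_one, Finset.inter_insert_of_mem hA]

theorem inter_range_succ_of_notMem (hA : m ∉ A) :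
    A ∩ Finset.range (m + 1) = A ∩ Finset.range m := by
  rw [Finset.range_add_one, Finset.inter_insert_of_notMem hA]

theorem notMem_of_mem_powerset_lower {L : Finset ℕ} (h : L ∈ (A ∩ Finset.range m).powerset) :
    m ∉ L := fun h' => by
  have := Finset.mem_powerset.1 h h'
  simp at this

theorem notMem_of_mem_powerset_upper {L : Finset ℕ} (h : L ∈ (Finset.range m \ B).powerset) :
    m ∉ L := fun h' => by
  have := Finset.mem_powerset.1 h h'
  simp at this

/-- Here and in the next three lemmas, column `m` sends into the white row one domino from below if
`m ∈ A` and one from above if `m ∉ B`. With no domino the required number jumps from `0` to `1`;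
with one domino it is preserved; with two, one must go left and the other right, in two ways, and it
drops from `1` to `0`. -/
theorem rowCount_insert_of_notMem (hA : m ∉ A) (t : ℕ) :
    rowCount ε A (m + 1) t (insert m B) = if t = 1 then rowCount ε A m 0 B else 0 := by
  rw [rowCount, range_succ_sdiff_insert, inter_range_succ_of_notMem hA, rowCount]
  split_ifs with ht
  all_goals
    first
    | refine Finset.sum_congr rfl fun L hL => Finset.sum_congr rfl fun L' hL' => ?_
    | refine Finset.sum_eq_zero fun L hL => Finset.sum_eq_zero fun L' hL' => ?_
    simp [Fits, leftCount, rightCount, fits_insert_right, hA, notMem_of_mem_powerset_lower hL,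
      notMem_of_mem_powerset_upper hL', ht, ind_of_not]

theorem rowCount_of_notMem (hA : m ∉ A) (hB : m ∉ B) {t : ℕ} (ht : t ≤ 1) :
    rowCount ε A (m + 1) t B = rowCount ε A m t B := by
  rw [rowCount, range_succ_sdiff hB, inter_range_succ_of_notMem hA, rowCount]
  refine Finset.sum_congr rfl fun L hL => ?_
  rw [Finset.sum_powerset_insert (by simp), ← Finset.sum_add_distrib]
  refine Finset.sum_congr rfl fun L' hL' => ?_
  have h1 := notMem_of_mem_powerset_lower hL
  have h2 := notMem_of_mem_powerset_upper hL'
  interval_cases t <;>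
  simp [Fits, leftCount, rightCount, fits_insert_upper, hA, hB, h1, h2, ind_of_not]

theorem rowCount_insert_of_mem (hA : m ∈ A) {t : ℕ} (ht : t ≤ 1) :
    rowCount ε A (m + 1) t (insert m B) = rowCount ε A m t B := by
  rw [rowCount, range_succ_sdiff_insert, inter_range_succ_of_mem hA, rowCount,
    Finset.sum_powerset_insert (by simp), ← Finset.sum_add_distrib]
  refine Finset.sum_congr rfl fun L hL => ?_
  rw [← Finset.sum_add_distrib]
  refine Finset.sum_congr rfl fun L' hL' => ?_
  have h1 := notMem_of_mem_powerset_lower hL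
  have h2 := notMem_of_mem_powerset_upper hL'
  interval_cases t <;>
  simp [Fits, leftCount, rightCount, fits_insert_right, fits_insert_lower, hA, h1, h2, ind_of_not]

theorem rowCount_of_mem (hε : ε ≤ 1) (hA : m ∈ A) (hB : m ∉ B) {t : ℕ} (ht : t ≤ 1) :
    rowCount ε A (m + 1) t B = if t = 0 then 2 * rowCount ε A m 1 B else 0 := by
  rw [rowCount, range_succ_sdiff hB, inter_range_succ_of_mem hA, rowCount,
    Finset.sum_powerset_insert (by simp), ← Finset.sum_add_distrib, Finset.mul_sum,
    ← mul_boole, Finset.sum_mul]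
  refine Finset.sum_congr rfl fun L hL => ?_
  rw [Finset.sum_powerset_insert (by simp), Finset.sum_powerset_insert (by simp),
    ← Finset.sum_add_distrib, ← Finset.sum_add_distrib, ← Finset.sum_add_distrib, Finset.mul_sum,
    Finset.sum_mul]
  refine Finset.sum_congr rfl fun L' hL' => ?_
  have h1 := notMem_of_mem_powerset_lower hL
  have h2 := notMem_of_mem_powerset_upper hL'
  have h3 := not_fits_two hε A B L L' m
  interval_cases t <;>
  simp [Fits, leftCount, rightCount, fits_insert_lower, fits_insert_upper, hA, hB, h1, h2, h3,
    ind_of_not, ← two_mul]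

end Recursion

/-- The wedge products over the sets `B`, summed with the multiplicities `rowCount`. -/
noncomputable def rowSum (ε : ℕ) (A : Finset ℕ) (v : Finset ℕ → ℕ → ExteriorAlgebra ℚ ℚ[X])
    (m t : ℕ) : ExteriorAlgebra ℚ ℚ[X] :=
  ∑ B ∈ (Finset.range m).powerset, rowCount ε A m t B • v B m

section RowSum

variable {ε : ℕ} {A : Finset ℕ} {v : Finset ℕ → ℕ → ExteriorAlgebra ℚ ℚ[X]} {m : ℕ}
  {p q : ExteriorAlgebra ℚ ℚ[X]}

/-- `p` and `q` are the factors that column `m` contributes to `v` when it lies in `B` and when it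
does not. -/
theorem rowSum_succ_of_notMem (hp : ∀ B, m ∉ B → v (insert m B) (m + 1) = p * v B m)
    (hq : ∀ B, m ∉ B → v B (m + 1) = q * v B m) (hA : m ∉ A) :
    rowSum ε A v (m + 1) 0 = q * rowSum ε A v m 0 ∧
      rowSum ε A v (m + 1) 1 = q * rowSum ε A v m 1 + p * rowSum ε A v m 0 := by
  simp only [rowSum, Finset.range_add_one, Finset.sum_powerset_insert Finset.notMem_range_self,
    Finset.mul_sum, ← Finset.sum_add_distrib]
  constructor <;> refine Finset.sum_congr rfl fun B hB => ?_
  all_goals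
    have hB : m ∉ B := fun h => Finset.notMem_range_self (Finset.mem_powerset.1 hB h)
    simp [rowCount_insert_of_notMem hA, rowCount_of_notMem hA hB, hp B hB, hq B hB]

theorem rowSum_succ_of_mem (hp : ∀ B, m ∉ B → v (insert m B) (m + 1) = p * v B m)
    (hq : ∀ B, m ∉ B → v B (m + 1) = q * v B m) (hε : ε ≤ 1) (hA : m ∈ A) :
    rowSum ε A v (m + 1) 0 = p * rowSum ε A v m 0 + (2 : ℚ) • (q * rowSum ε A v m 1) ∧
      rowSum ε A v (m + 1) 1 = p * rowSum ε A v m 1 := by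
  simp only [rowSum, Finset.range_add_one, Finset.sum_powerset_insert Finset.notMem_range_self,
    Finset.mul_sum, Finset.smul_sum, ← Finset.sum_add_distrib]
  constructor <;> refine Finset.sum_congr rfl fun B hB => ?_
  all_goals
    have hB : m ∉ B := fun h => Finset.notMem_range_self (Finset.mem_powerset.1 hB h)
    simp [rowCount_insert_of_mem hA, rowCount_of_mem hε hA hB, hp B hB, hq B hB, smul_smul,
      add_comm]

end RowSum

/-- The number of ways to cover a row of white squares between two rows of `N` black squares whose
dominoes go up in the columns of `A` and of `B`, respectively. -/
noncomputable def transfer (ε N : ℕ) (A B : Finset ℕ) : ℚ := rowCount ε A N (1 - ε) B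

/-- The column recursion is that of `descent_wedge_of_recursion` with the states `0`, `1` as `S₀`,
`S₁`; the two ways of placing a pair of dominoes give `w₁ = 2`, hence a factor `2` per row. -/
theorem sum_transfer_one_mul_weight (N i : ℕ) (A : Finset ℕ) :
    ∑ B ∈ (Finset.range N).powerset, transfer 1 N A B * weight N i B =
      2 * weight N (i + 1) A := by
  have h := descent_wedge_of_recursion (lcoeff ℚ 0) lower (fun m => (1 + X : ℚ[X]) ^ m)
    (fun m => by simp [coeff_zero_eq_eval_zero]) lower_pow_succ A 1 2 (by norm_num)
    (rowSum 1 A (fun B m => wedge (fun m => (1 + X : ℚ[X]) ^ m) B m) · 0)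
    (rowSum 1 A (fun B m => wedge (fun m => (1 + X : ℚ[X]) ^ m) B m) · 1)
    (by simp [rowSum, rowCount, Fits, ind_of_not]) (by simp [rowSum, rowCount, Fits, wedge, ind_of])
    N ?_ ?_
  · have := congrArg (flagForm (lcoeff ℚ 0) lower i) h.1
    rw [rowSum, map_sum, map_smul, ← flagForm_succ] at this
    simp only [map_smul, smul_eq_mul] at this
    exact this
  all_goals
    intro m _ hm
    have hp (B : Finset ℕ) (hB : m ∉ B) : wedge (fun m => (1 + X : ℚ[X]) ^ m)
        ((insert m B : Finset ℕ) : Set ℕ) (m + 1) =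
        ι ℚ ((1 + X : ℚ[X]) ^ m) * wedge (fun m => (1 + X : ℚ[X]) ^ m) B m := by
      rw [wedge_succ_of_mem (by simp)]
      congr 1
      exact wedge_congr fun j hj => by simp [hj.ne]
    have hq (B : Finset ℕ) (hB : m ∉ B) : wedge (fun m => (1 + X : ℚ[X]) ^ m) B (m + 1) =
        1 * wedge (fun m => (1 + X : ℚ[X]) ^ m) B m := by
      rw [wedge_succ_of_notMem (by simpa using hB), one_mul]
  · have := rowSum_succ_of_mem hp hq le_rfl (Finset.mem_coe.1 hm)
    simpa using this
  · have := rowSum_succ_of_notMem (ε := 1) hp hq (mt Finset.mem_coe.2 hm)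
    simpa using this

/-- Taking complements and exchanging the two states gives the same recursion, but now the `2`
becomes `w₀`, so no factor appears. -/
theorem sum_transfer_zero_mul_weight (N i : ℕ) (A : Finset ℕ) :
    ∑ B ∈ (Finset.range N).powerset, transfer 0 N A B * weight N i (B : Set ℕ)ᶜ =
      weight N (i + 1) (A : Set ℕ)ᶜ := by
  have h := descent_wedge_of_recursion (lcoeff ℚ 0) lower (fun m => (1 + X : ℚ[X]) ^ m)
    (fun m => by simp [coeff_zero_eq_eval_zero]) lower_pow_succ (A : Set ℕ)ᶜ 2 1 (by norm_num)
    (rowSum 0 A (fun B m => wedge (fun m => (1 + X : ℚ[X]) ^ m) (B : Set ℕ)ᶜ m) · 1)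
    (rowSum 0 A (fun B m => wedge (fun m => (1 + X : ℚ[X]) ^ m) (B : Set ℕ)ᶜ m) · 0)
    (by simp [rowSum, rowCount, Fits, ind_of_not]) (by simp [rowSum, rowCount, Fits, wedge, ind_of])
    N ?_ ?_
  · have := congrArg (flagForm (lcoeff ℚ 0) lower i) h.1
    rw [rowSum, map_sum, map_smul, ← flagForm_succ] at this
    simp only [map_smul, smul_eq_mul, one_mul] at this
    exact this
  all_goals
    intro m _ hm
    have hp (B : Finset ℕ) (hB : m ∉ B) : wedge (fun m => (1 + X : ℚ[X]) ^ m)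
        ((insert m B : Finset ℕ) : Set ℕ)ᶜ (m + 1) =
        1 * wedge (fun m => (1 + X : ℚ[X]) ^ m) (B : Set ℕ)ᶜ m := by
      rw [wedge_succ_of_notMem (by simp), one_mul]
      exact wedge_congr fun j hj => by simp [hj.ne]
    have hq (B : Finset ℕ) (hB : m ∉ B) : wedge (fun m => (1 + X : ℚ[X]) ^ m)
        (B : Set ℕ)ᶜ (m + 1) =
        ι ℚ ((1 + X : ℚ[X]) ^ m) * wedge (fun m => (1 + X : ℚ[X]) ^ m) (B : Set ℕ)ᶜ m := by
      rw [wedge_succ_of_mem (by simpa using hB)]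
  · have := rowSum_succ_of_notMem (ε := 0) hp hq (by simpa using hm)
    simpa using this.symm
  · have := rowSum_succ_of_mem (ε := 0) hp hq zero_le_one (by simpa using hm)
    simpa using this.symm

end Aztec

/-! ### Composing the transfer matrices of all rows. -/

namespace Aztec

open ExteriorAlgebra Polynomial

/-- The matrix product of the row vector `g` with `K 0, …, K (m - 1)`, over the index set `P`. -/
def forward {α : Type*} (P : Finset α) (g : α → ℚ) (K : ℕ → α → α → ℚ) : ℕ → α → ℚ
  | 0 => g
  | m + 1 => fun b => ∑ a ∈ P, forward P g K m a * K m a b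

theorem sum_path_eq {α : Type*} (P : Finset α) (g : α → ℚ) (K : ℕ → α → α → ℚ) (m : ℕ)
    (h : α → ℚ) :
    ∑ U : Fin (m + 1) → P, g (U 0) * (∏ i : Fin m, K i (U i.castSucc) (U i.succ)) *
      h (U (Fin.last m)) = ∑ b ∈ P, forward P g K m b * h b := by
  induction m generalizing h with
  | zero =>
    rw [← Finset.sum_coe_sort P]
    exact Fintype.sum_equiv (Equiv.funUnique (Fin 1) P) _ _ fun U => by
      simp only [Finset.univ_eq_empty, Finset.prod_empty, mul_one]
      rfl
  | succ m ih =>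
    have e := (Fin.snocEquiv (fun _ : Fin (m + 2) => P)).sum_comp fun U =>
      g (U 0) * (∏ i : Fin (m + 1), K i (U i.castSucc) (U i.succ)) * h (U (Fin.last (m + 1)))
    rw [← e, Fintype.sum_prod_type]
    have (b : P) : ∑ U : Fin (m + 1) → P,
        g (Fin.snocEquiv (fun _ : Fin (m + 2) => P) (b, U) 0) *
          (∏ i : Fin (m + 1), K i (Fin.snocEquiv (fun _ : Fin (m + 2) => P) (b, U) i.castSucc)
            (Fin.snocEquiv (fun _ : Fin (m + 2) => P) (b, U) i.succ)) *
          h (Fin.snocEquiv (fun _ : Fin (m + 2) => P) (b, U) (Fin.last (m + 1))) =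
        forward P g K (m + 1) b * h b := by
      have hf : forward P g K (m + 1) b = ∑ a ∈ P, forward P g K m a * K m a b := rfl
      rw [hf, ← ih fun a => K m a b, Finset.sum_mul]
      refine Finset.sum_congr rfl fun U _ => ?_
      have s0 : Fin.snocEquiv (fun _ : Fin (m + 2) => P) (b, U) 0 = U 0 := by
        rw [← Fin.castSucc_zero]
        simp [Fin.snocEquiv]
      rw [Fin.prod_univ_castSucc, s0]
      simp [Fin.snocEquiv, ← Fin.castSucc_succ, mul_assoc]
    rw [Finset.sum_congr rfl fun b _ => this b,
      Finset.sum_coe_sort P fun b => forward P g K (m + 1) b * h b]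

theorem weight_zero {N : ℕ} {A : Finset ℕ} (hA : A ⊆ Finset.range N) :
    weight N 0 A = if A = ∅ then 1 else 0 := by
  split_ifs with h
  · subst h
    have : wedge (fun m => (1 + X : ℚ[X]) ^ m) ((∅ : Finset ℕ) : Set ℕ) N = 1 := by
      induction N with
      | zero => rfl
      | succ N ih => rw [wedge_succ_of_notMem (by simp), ih (by simp)]
    rw [weight, this, flagForm_zero, map_one]
  · exact flagForm_wedge_eq_zero _ _ _ hA (by simpa using h)

theorem weight_sdiff (N i : ℕ) (A : Finset ℕ) :
    weight N i ((Finset.range N \ A : Finset ℕ) : Set ℕ) = weight N i (A : Set ℕ)ᶜ := by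
  rw [weight, weight]
  congr 1
  exact wedge_congr fun j hj => by simp [hj]

/-- The columns of the last row of black squares whose dominoes go up (in the fictitious row above
the diamond, if `ε = 0`). -/
def topSet (ε N : ℕ) : Finset ℕ := if ε = 1 then ∅ else Finset.range N

/-- The number of coverings of the upper `i` rows of white squares, given the set of columns in
which the dominoes of the row of black squares below them go up. -/
noncomputable def above (ε N : ℕ) : ℕ → Finset ℕ → ℚ
  | 0, A => if A = topSet ε N then 1 else 0
  | i + 1, A => ∑ B ∈ (Finset.range N).powerset, transfer ε N A B * above ε N i B

theorem above_one (N i : ℕ) {A : Finset ℕ} (hA : A ⊆ Finset.range N) :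
    above 1 N i A = 2 ^ i * weight N i A := by
  induction i generalizing A with
  | zero => rw [above, weight_zero hA, topSet, if_pos rfl, pow_zero, one_mul]
  | succ i ih =>
    rw [above, pow_succ, mul_assoc, ← sum_transfer_one_mul_weight, Finset.mul_sum]
    refine Finset.sum_congr rfl fun B hB => ?_
    rw [ih (Finset.mem_powerset.1 hB)]
    ring

theorem above_zero (N i : ℕ) {A : Finset ℕ} (hA : A ⊆ Finset.range N) :
    above 0 N i A = weight N i (A : Set ℕ)ᶜ := by
  induction i generalizing A with
  | zero =>
    rw [above, ← weight_sdiff, weight_zero Finset.sdiff_subset, topSet, if_neg zero_ne_one]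
    refine if_congr ?_ rfl rfl
    rw [Finset.sdiff_eq_empty_iff_subset]
    exact ⟨fun h => h ▸ subset_rfl, fun h => hA.antisymm h⟩
  | succ i ih =>
    rw [above, ← sum_transfer_zero_mul_weight]
    refine Finset.sum_congr rfl fun B hB => ?_
    rw [ih (Finset.mem_powerset.1 hB)]

theorem rowCount_compl (ε t N : ℕ) {A : Finset ℕ} (hA : A ⊆ Finset.range N) (B : Finset ℕ) :
    rowCount ε (Finset.range N \ B) N t (Finset.range N \ A) = rowCount ε A N t B := by
  rw [rowCount, rowCount, Finset.sum_comm, Finset.sdiff_sdiff_eq_self hA,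
    Finset.inter_eq_left.2 hA, Finset.inter_eq_left.2 Finset.sdiff_subset]
  simp only [fits_compl le_rfl]

theorem sum_powerset_compl (N : ℕ) (f : Finset ℕ → ℚ) :
    ∑ A ∈ (Finset.range N).powerset, f (Finset.range N \ A) =
      ∑ A ∈ (Finset.range N).powerset, f A := by
  refine Finset.sum_nbij' (fun A => Finset.range N \ A) (fun A => Finset.range N \ A) ?_ ?_ ?_ ?_ ?_
  · simp
  · simp
  · exact fun A hA => Finset.sdiff_sdiff_eq_self (Finset.mem_powerset.1 hA)
  · exact fun A hA => Finset.sdiff_sdiff_eq_self (Finset.mem_powerset.1 hA)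
  · simp

/-- The transfer matrices of the white rows, with a condition on the `k`-th row of black
squares. -/
noncomputable def step (ε N k : ℕ) (mid : Finset ℕ → ℚ) (i : ℕ) (A B : Finset ℕ) : ℚ :=
  transfer ε N A B * if i = k then mid A else 1

/-- The lower half, read upside down, is an upper half with complemented sets. The condition `mid`
acts only in step `k`, which has not been reached. -/
theorem forward_step_of_le (ε N k : ℕ) (mid : Finset ℕ → ℚ) {i : ℕ} (hi : i ≤ k) {A : Finset ℕ}
    (hA : A ⊆ Finset.range N) :
    forward (Finset.range N).powerset
      (fun A => if Finset.range N \ A = topSet ε N then 1 else 0) (step ε N k mid) i A =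
      above ε N i (Finset.range N \ A) := by
  induction i generalizing A with
  | zero => rfl
  | succ i ih =>
    rw [forward, above, ← sum_powerset_compl]
    refine Finset.sum_congr rfl fun B hB => ?_
    have hB := Finset.mem_powerset.1 hB
    rw [ih (by omega) hB, step, if_neg (by omega),
      mul_one, mul_comm, transfer, transfer,
      rowCount_compl _ _ _ hB]

/-- The pairing of what lies below a cut with what lies above it does not change as the cut moves
up; it is evaluated with the cut at the spine. -/
theorem sum_forward_step (ε N k : ℕ) (mid : Finset ℕ → ℚ) {i : ℕ} (hi : i < k) :
    ∑ B ∈ (Finset.range N).powerset, forward (Finset.range N).powerset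
      (fun A => if Finset.range N \ A = topSet ε N then 1 else 0) (step ε N k mid) (k + i + 1) B *
        above ε N (k - i - 1) B =
      ∑ A ∈ (Finset.range N).powerset,
        mid A * (above ε N k (Finset.range N \ A) * above ε N k A) := by
  induction i with
  | zero =>
    simp only [forward, Finset.sum_mul]
    rw [Finset.sum_comm]
    refine Finset.sum_congr rfl fun A hA => ?_
    obtain ⟨l, rfl⟩ : ∃ l, k = l + 1 := ⟨k - 1, by omega⟩
    rw [above.eq_2 ε N A l, Finset.mul_sum, Finset.mul_sum]
    refine Finset.sum_congr rfl fun B hB => ?_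
    rw [forward_step_of_le _ _ _ _ le_rfl (Finset.mem_powerset.1 hA), step, if_pos rfl]
    simp only [Nat.sub_zero, Nat.add_sub_cancel]
    ring
  | succ i ih =>
    rw [← ih (by omega)]
    simp only [forward.eq_2 _ _ _ (k + (i + 1)), Finset.sum_mul]
    rw [Finset.sum_comm]
    refine Finset.sum_congr rfl fun A hA => ?_
    obtain ⟨l, hl⟩ : ∃ l, k - i - 1 = l + 1 := ⟨k - i - 2, by omega⟩
    rw [hl, above.eq_2 ε N A l, Finset.mul_sum]
    refine Finset.sum_congr rfl fun B hB => ?_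
    rw [step, if_neg (by omega), show k - (i + 1) - 1 = l by omega, add_assoc k i 1]
    ring

/-- The weighted number of row-by-row descriptions of tilings. -/
theorem sum_paths (ε k : ℕ) (hε : ε = 0 ∨ ε = 1) (hk : 0 < k) (z : ℕ → Prop) [DecidablePred z] :
    ∑ U : Fin (2 * k + 1) → (Finset.range (2 * k)).powerset,
      (if Finset.range (2 * k) \ U 0 = topSet ε (2 * k) then (1 : ℚ) else 0) *
        (∏ i : Fin (2 * k), step ε (2 * k) k
          (fun A => if ∀ j < k, 2 * j + 1 ∈ A ↔ z j then 1 else 0) i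
          (U i.castSucc) (U i.succ)) *
        (if (U (Fin.last (2 * k)) : Finset ℕ) = topSet ε (2 * k) then (1 : ℚ) else 0) =
      (if ε = 1 then 4 ^ k else 1) * 4 ^ (k * (k - 1)) := by
  rw [sum_path_eq _ (fun A => if Finset.range (2 * k) \ A = topSet ε (2 * k) then (1 : ℚ) else 0)
    (step ε (2 * k) k (fun A => if ∀ j < k, 2 * j + 1 ∈ A ↔ z j then 1 else 0)) (2 * k)
    (fun A => if A = topSet ε (2 * k) then (1 : ℚ) else 0)]
  -- With `i = k - 1` the cut is at the last black row, where `above` is the boundary condition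
  -- itself.
  have h := sum_forward_step ε (2 * k) k (fun A => if ∀ j < k, 2 * j + 1 ∈ A ↔ z j then 1 else 0)
    (i := k - 1) (by omega)
  rw [show k + (k - 1) + 1 = 2 * k by omega, show k - (k - 1) - 1 = 0 by omega] at h
  simp only [above.eq_1] at h
  rw [h]
  have hsq := sum_weight_mul_weight_sq z k
  have habove (A : Finset ℕ) (hA : A ⊆ Finset.range (2 * k)) :
      above ε (2 * k) k (Finset.range (2 * k) \ A) * above ε (2 * k) k A =
        (if ε = 1 then 4 ^ k else 1) *
          (weight (2 * k) k A * weight (2 * k) k (A : Set ℕ)ᶜ) := by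
    rcases hε with rfl | rfl
    · rw [above_zero _ _ hA, above_zero _ _ Finset.sdiff_subset, if_neg zero_ne_one, one_mul]
      congr 1
      rw [← weight_sdiff, Finset.sdiff_sdiff_eq_self hA]
    · rw [above_one _ _ hA, above_one _ _ Finset.sdiff_subset, if_pos rfl, weight_sdiff,
        show (4 : ℚ) = 2 * 2 by norm_num, mul_pow]
      ring
  -- Nonnegativity of the counts selects the root `S = 4 ^ (k * (k - 1))` of `hsq`.
  have hnonneg (i : ℕ) (A : Finset ℕ) : 0 ≤ above ε (2 * k) i A := by
    induction i generalizing A with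
    | zero => rw [above]; split_ifs <;> norm_num
    | succ i ih =>
      refine Finset.sum_nonneg fun B _ => mul_nonneg (Finset.sum_nonneg fun L _ =>
        Finset.sum_nonneg fun L' _ => ?_) (ih B)
      rw [ind]
      split_ifs <;> norm_num
  set S := ∑ A ∈ (Finset.range (2 * k)).powerset with ∀ j < k, 2 * j + 1 ∈ A ↔ z j,
    weight (2 * k) k A * weight (2 * k) k (A : Set ℕ)ᶜ with hS
  have hsum : ∑ A ∈ (Finset.range (2 * k)).powerset,
      (if ∀ j < k, 2 * j + 1 ∈ A ↔ z j then 1 else 0) *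
        (above ε (2 * k) k (Finset.range (2 * k) \ A) * above ε (2 * k) k A) =
      (if ε = 1 then 4 ^ k else 1) * S := by
    rw [hS, Finset.sum_filter, Finset.mul_sum]
    refine Finset.sum_congr rfl fun A hA => ?_
    rw [habove A (Finset.mem_powerset.1 hA)]
    by_cases hz : ∀ j < k, 2 * j + 1 ∈ A ↔ z j
    · rw [if_pos hz, if_pos hz, one_mul]
    · rw [if_neg hz, if_neg hz, zero_mul, mul_zero]
  have hc : (0 : ℚ) < if ε = 1 then 4 ^ k else 1 := by split_ifs <;> positivity
  have hpos : 0 ≤ S := by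
    refine nonneg_of_mul_nonneg_right (hsum ▸ Finset.sum_nonneg fun A _ => ?_) hc
    exact mul_nonneg (by split_ifs <;> norm_num) (mul_nonneg (hnonneg _ _) (hnonneg _ _))
  rw [hsum, (sq_eq_sq₀ hpos (by positivity)).1 hsq]

end Aztec

/-! ### Counting row-by-row descriptions of tilings. -/

namespace Aztec

open Classical in
/-- The ways to cover a row of white squares, given by the columns of the row below and of the row
above from which a domino goes left. -/
noncomputable def rowSet (ε N : ℕ) (A B : Finset ℕ) : Finset (Finset ℕ × Finset ℕ) :=
  {x ∈ A.powerset ×ˢ (Finset.range N \ B).powerset | Fits ε A B x.1 x.2 N (1 - ε)}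

theorem card_rowSet (ε N : ℕ) {A : Finset ℕ} (hA : A ⊆ Finset.range N) (B : Finset ℕ) :
    ((rowSet ε N A B).card : ℚ) = transfer ε N A B := by
  classical
  rw [rowSet, Finset.card_filter, Finset.sum_product, transfer, rowCount, Finset.inter_eq_left.2 hA]
  push_cast
  simp only [ind]

open Classical in
/-- The row-by-row descriptions of tilings: the columns in which the dominoes of each row of black
squares go up, and the ways to cover the rows of white squares. -/
noncomputable def codes (ε k : ℕ) (z : ℕ → Prop) :
    Finset ((_ : Fin (2 * k + 1) → (Finset.range (2 * k)).powerset) ×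
      (Fin (2 * k) → Finset ℕ × Finset ℕ)) :=
  ({U | Finset.range (2 * k) \ U 0 = topSet ε (2 * k) ∧
    (∀ j < k, 2 * j + 1 ∈ (U ⟨k, by omega⟩ : Finset ℕ) ↔ z j) ∧
    (U (Fin.last (2 * k)) : Finset ℕ) = topSet ε (2 * k)} : Finset _).sigma
    fun U => Fintype.piFinset fun r => rowSet ε (2 * k) (U r.castSucc) (U r.succ)

theorem card_codes (ε k : ℕ) (hε : ε = 0 ∨ ε = 1) (hk : 0 < k) (z : ℕ → Prop) :
    ((codes ε k z).card : ℚ) = (if ε = 1 then 4 ^ k else 1) * 4 ^ (k * (k - 1)) := by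
  classical
  rw [← sum_paths ε k hε hk z, codes, Finset.card_sigma, Finset.sum_filter]
  push_cast
  refine Finset.sum_congr rfl fun U _ => ?_
  have hstep : (∏ i : Fin (2 * k), step ε (2 * k) k
      (fun A => if ∀ j < k, 2 * j + 1 ∈ A ↔ z j then 1 else 0) i (U i.castSucc) (U i.succ)) =
      (∏ i : Fin (2 * k), transfer ε (2 * k) (U i.castSucc) (U i.succ)) *
        if ∀ j < k, 2 * j + 1 ∈ (U ⟨k, by omega⟩ : Finset ℕ) ↔ z j then 1 else 0 := by
    simp only [step]
    rw [Finset.prod_mul_distrib]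
    congr 1
    -- Only step `k`, which starts from the spine row, carries the condition; `0 < k` ensures that
    -- there is such a step.
    rw [Finset.prod_eq_single (⟨k, by omega⟩ : Fin (2 * k)), if_pos rfl]
    · rfl
    · intro i _ hi
      rw [if_neg fun h => hi (Fin.ext h)]
    · exact fun h => absurd (Finset.mem_univ _) h
  rw [hstep, Fintype.card_piFinset]
  push_cast
  have hcard (i : Fin (2 * k)) := card_rowSet ε (2 * k)
    (Finset.mem_powerset.1 (U i.castSucc).2) (U i.succ)
  simp only [hcard]
  by_cases h0 : Finset.range (2 * k) \ U 0 = topSet ε (2 * k)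
  · by_cases h1 : ∀ j < k, 2 * j + 1 ∈ (U ⟨k, by omega⟩ : Finset ℕ) ↔ z j
    · by_cases h2 : (U (Fin.last (2 * k)) : Finset ℕ) = topSet ε (2 * k)
      · rw [if_pos ⟨h0, h1, h2⟩, if_pos h0, if_pos h1, if_pos h2, one_mul, mul_one, mul_one]
      · rw [if_neg fun h => h2 h.2.2, if_neg h2, mul_zero]
    · rw [if_neg fun h => h1 h.2.1, if_neg h1, mul_zero, mul_zero, zero_mul]
  · rw [if_neg fun h => h0 h.1, if_neg h0, zero_mul, zero_mul]

end Aztec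

/-! ### Rotated coordinates, and tilings as layouts. -/

namespace Aztec

/-- The `j`-th black square of the `r`-th row of black squares (along lines of slope 1, from the
southeast to the northwest). -/
def blackSquare (k r j : ℕ) : Square := ((j : ℤ) - r, (j : ℤ) + r - 2 * k)

/-- The white square between the columns `j - 1` and `j` and between the rows `r` and `r + 1` of
black squares. -/
def whiteSquare (k r j : ℕ) : Square := ((j : ℤ) - r - 1, (j : ℤ) + r - 2 * k)

/-- The range of the indices of black squares in the diamond of order `2 * k - 1 + ε`. -/
def IsBlack (ε k r j : ℕ) : Prop := j < 2 * k ∧ r ≤ 2 * k ∧ 1 ≤ r + ε ∧ r + 1 ≤ 2 * k + ε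

/-- The range of the indices of white squares in the diamond of order `2 * k - 1 + ε`. -/
def IsWhite (ε k r j : ℕ) : Prop := r < 2 * k ∧ j ≤ 2 * k ∧ 1 ≤ j + ε ∧ j + 1 ≤ 2 * k + ε

/-- The white neighbor of a black square on the given side belongs to the diamond. -/
def HasNeighbor (ε k r j : ℕ) : Side → Prop
  | Side.left => IsWhite ε k r j
  | Side.top => IsWhite ε k r (j + 1)
  | Side.bottom => 1 ≤ r ∧ IsWhite ε k (r - 1) j
  | Side.right => 1 ≤ r ∧ IsWhite ε k (r - 1) (j + 1)

/-- The domino that covers a black square and its neighbor on the given side. -/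
def dom (k r j : ℕ) (s : Side) : Finset Square :=
  {blackSquare k r j, neighbor (blackSquare k r j) s}

variable {n k ε : ℕ}

theorem blackSquare_mem (hn : n + 1 = 2 * k + ε) (hε : ε ≤ 1) (r j : ℕ) :
    blackSquare k r j ∈ diamond n ↔ IsBlack ε k r j := by
  simp only [diamond, blackSquare, IsBlack, Set.mem_ofPred_eq]
  rcases abs_cases (2 * ((j : ℤ) - r) + 1) with h1 | h1 <;>
    rcases abs_cases (2 * ((j : ℤ) + r - 2 * k) + 1) with h2 | h2 <;> omega

theorem whiteSquare_mem (hn : n + 1 = 2 * k + ε) (hε : ε ≤ 1) (r j : ℕ) :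
    whiteSquare k r j ∈ diamond n ↔ IsWhite ε k r j := by
  simp only [diamond, whiteSquare, IsWhite, Set.mem_ofPred_eq]
  rcases abs_cases (2 * ((j : ℤ) - r - 1) + 1) with h1 | h1 <;>
    rcases abs_cases (2 * ((j : ℤ) + r - 2 * k) + 1) with h2 | h2 <;> omega

theorem exists_index (hn : n + 1 = 2 * k + ε) (hε : ε ≤ 1) {p : Square} (hp : p ∈ diamond n) :
    (∃ r j, IsBlack ε k r j ∧ p = blackSquare k r j) ∨
      ∃ r j, IsWhite ε k r j ∧ p = whiteSquare k r j := by
  obtain ⟨x, y⟩ := p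
  have hp' : |2 * x + 1| + |2 * y + 1| ≤ 2 * (n : ℤ) := hp
  rcases Int.even_or_odd' (x + y) with ⟨c, h | h⟩
  · left
    have e : ((x, y) : Square) = blackSquare k (c - x + k).toNat (c + k).toNat := by
      simp only [blackSquare, Prod.mk.injEq]
      rcases abs_cases (2 * x + 1) with h1 | h1 <;> rcases abs_cases (2 * y + 1) with h2 | h2 <;>
        omega
    exact ⟨_, _, (blackSquare_mem hn hε _ _).1 (e ▸ hp), e⟩
  · right
    have e : ((x, y) : Square) = whiteSquare k (c - x + k).toNat (c + 1 + k).toNat := by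
      simp only [whiteSquare, Prod.mk.injEq]
      rcases abs_cases (2 * x + 1) with h1 | h1 <;> rcases abs_cases (2 * y + 1) with h2 | h2 <;>
        omega
    exact ⟨_, _, (whiteSquare_mem hn hε _ _).1 (e ▸ hp), e⟩

theorem neighbor_mem (hn : n + 1 = 2 * k + ε) (hε : ε ≤ 1) {r j : ℕ} (h : IsBlack ε k r j)
    (s : Side) : neighbor (blackSquare k r j) s ∈ diamond n ↔ HasNeighbor ε k r j s := by
  simp only [IsBlack] at h
  cases s <;> simp only [HasNeighbor, IsWhite, neighbor, diamond, blackSquare, Set.mem_ofPred_eq]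
  · rcases abs_cases (2 * ((j : ℤ) - r - 1) + 1) with h1 | h1 <;>
      rcases abs_cases (2 * ((j : ℤ) + r - 2 * k) + 1) with h2 | h2 <;> omega
  · rcases abs_cases (2 * ((j : ℤ) - r + 1) + 1) with h1 | h1 <;>
      rcases abs_cases (2 * ((j : ℤ) + r - 2 * k) + 1) with h2 | h2 <;> omega
  · rcases abs_cases (2 * ((j : ℤ) - r) + 1) with h1 | h1 <;>
      rcases abs_cases (2 * ((j : ℤ) + r - 2 * k + 1) + 1) with h2 | h2 <;> omega
  · rcases abs_cases (2 * ((j : ℤ) - r) + 1) with h1 | h1 <;>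
      rcases abs_cases (2 * ((j : ℤ) + r - 2 * k - 1) + 1) with h2 | h2 <;> omega

theorem blackSquare_inj {r j r' j' : ℕ} (h : blackSquare k r j = blackSquare k r' j') :
    r = r' ∧ j = j' := by
  simp only [blackSquare, Prod.mk.injEq] at h
  omega

theorem neighbor_inj {p : Square} {s s' : Side} (h : neighbor p s = neighbor p s') : s = s' := by
  cases s <;> cases s' <;> simp only [neighbor, Prod.mk.injEq] at h <;> first | rfl | omega

theorem blackSquare_ne_neighbor (r j r' j' : ℕ) (s : Side) :
    blackSquare k r j ≠ neighbor (blackSquare k r' j') s := by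
  cases s <;> simp only [blackSquare, neighbor, ne_eq, Prod.mk.injEq] <;> omega

theorem blackSquare_mem_dom {r j r' j' : ℕ} {s : Side} :
    blackSquare k r j ∈ dom k r' j' s ↔ r = r' ∧ j = j' := by
  rw [dom, Finset.mem_insert, Finset.mem_singleton]
  constructor
  · rintro (h | h)
    · exact blackSquare_inj h
    · exact absurd h (blackSquare_ne_neighbor _ _ _ _ _)
  · rintro ⟨rfl, rfl⟩
    exact Or.inl rfl

theorem dom_inj {r j r' j' : ℕ} {s s' : Side} (h : dom k r j s = dom k r' j' s') :
    r = r' ∧ j = j' ∧ s = s' := by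
  obtain ⟨rfl, rfl⟩ := blackSquare_mem_dom.1 (h ▸ blackSquare_mem_dom.2 ⟨rfl, rfl⟩ :
    blackSquare k r j ∈ dom k r' j' s')
  refine ⟨rfl, rfl, ?_⟩
  have h1 : neighbor (blackSquare k r j) s ∈ dom k r j s' := by
    rw [← h, dom]
    simp
  rw [dom, Finset.mem_insert, Finset.mem_singleton] at h1
  rcases h1 with h1 | h1
  · exact absurd h1.symm (blackSquare_ne_neighbor _ _ _ _ _)
  · exact neighbor_inj h1

theorem whiteSquare_mem_dom {r j r' j' : ℕ} {s : Side} :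
    whiteSquare k r j ∈ dom k r' j' s ↔ (s = Side.left ∧ r' = r ∧ j' = j) ∨
      (s = Side.top ∧ r' = r ∧ j' + 1 = j) ∨ (s = Side.bottom ∧ r' = r + 1 ∧ j' = j) ∨
        (s = Side.right ∧ r' = r + 1 ∧ j' + 1 = j) := by
  rw [dom, Finset.mem_insert, Finset.mem_singleton]
  cases s <;> simp only [whiteSquare, blackSquare, neighbor, Prod.mk.injEq, reduceCtorEq, false_and,
    true_and, or_false, false_or] <;> omega

open Classical in
/-- The indicator of a proposition as a natural number. -/
noncomputable def count (p : Prop) : ℕ := if p then 1 else 0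

theorem existsUnique_iff_count {α : Type*} {a b c d : α} (hab : a ≠ b) (hac : a ≠ c) (had : a ≠ d)
    (hbc : b ≠ c) (hbd : b ≠ d) (hcd : c ≠ d) (p q r s : Prop) :
    (∃! x, (x = a ∧ p) ∨ (x = b ∧ q) ∨ (x = c ∧ r) ∨ (x = d ∧ s)) ↔
      count p + count q + count r + count s = 1 := by
  by_cases hp : p <;> by_cases hq : q <;> by_cases hr : r <;> by_cases hs : s <;>
    simp [hp, hq, hr, hs, count, ExistsUnique, hab, hac, had, hbc, hbd, hcd, hab.symm, hac.symm,
      had.symm, hbc.symm, hbd.symm, hcd.symm]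

/-- A description of a tiling by the set of its dominoes. -/
structure IsLayout (ε k : ℕ) (H : ℕ → ℕ → Side → Prop) : Prop where
  isBlack : ∀ {r j s}, H r j s → IsBlack ε k r j
  hasNeighbor : ∀ {r j s}, H r j s → HasNeighbor ε k r j s
  black : ∀ {r j}, IsBlack ε k r j → count (H r j Side.left) + count (H r j Side.top) +
    count (H r j Side.bottom) + count (H r j Side.right) = 1
  white_zero : ∀ {r}, IsWhite ε k r 0 → count (H r 0 Side.left) +
    count (H (r + 1) 0 Side.bottom) = 1
  white_succ : ∀ {r j}, IsWhite ε k r (j + 1) → count (H r j Side.top) +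
    count (H (r + 1) j Side.right) + (count (H r (j + 1) Side.left) +
      count (H (r + 1) (j + 1) Side.bottom)) = 1

/-- Adjacent squares have opposite colours. If the given base square is white, the domino is
described from its other square by the opposite side. -/
theorem exists_dom (hn : n + 1 = 2 * k + ε) (hε : ε ≤ 1) {D : Finset Square} (hD : IsDomino D)
    (hsub : (D : Set Square) ⊆ diamond n) :
    ∃ r j s, IsBlack ε k r j ∧ HasNeighbor ε k r j s ∧ D = dom k r j s := by
  obtain ⟨p, s, rfl⟩ := hD
  have hp : p ∈ diamond n := hsub (by simp)
  have hq : neighbor p s ∈ diamond n := hsub (by simp)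
  rcases exists_index hn hε hp with ⟨r, j, hb, rfl⟩ | ⟨r, j, hw, rfl⟩
  · exact ⟨r, j, s, hb, (neighbor_mem hn hε hb s).1 hq, rfl⟩
  · obtain ⟨s', hs'⟩ : ∃ s', whiteSquare k r j = neighbor (neighbor (whiteSquare k r j) s) s' := by
      cases s
      · exact ⟨Side.right, by simp [neighbor]⟩
      · exact ⟨Side.left, by simp [neighbor]⟩
      · exact ⟨Side.bottom, by simp [neighbor]⟩
      · exact ⟨Side.top, by simp [neighbor]⟩
    rcases exists_index hn hε hq with ⟨r', j', hb, e⟩ | ⟨r', j', hw', e⟩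
    · refine ⟨r', j', s', hb, (neighbor_mem hn hε hb s').1 (e ▸ hs' ▸ hp), ?_⟩
      rw [dom, ← e, ← hs', Finset.pair_comm]
    · exfalso
      cases s <;> simp only [whiteSquare, neighbor, Prod.mk.injEq] at e <;> omega

theorem black_iff (T : Finset (Finset Square)) (hT : ∀ D ∈ T, ∃ r j s, D = dom k r j s) (r j : ℕ) :
    (∃! D, D ∈ T ∧ blackSquare k r j ∈ D) ↔
      count (dom k r j Side.left ∈ T) + count (dom k r j Side.top ∈ T) +
        count (dom k r j Side.bottom ∈ T) + count (dom k r j Side.right ∈ T) = 1 := by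
  rw [← existsUnique_iff_count (a := dom k r j Side.left) (b := dom k r j Side.top)
    (c := dom k r j Side.bottom) (d := dom k r j Side.right)]
  rotate_left
  iterate 6 exact fun h => by simpa using (dom_inj h).2.2
  refine existsUnique_congr fun D => ?_
  constructor
  · rintro ⟨hD, hb⟩
    obtain ⟨r', j', s, rfl⟩ := hT D hD
    obtain ⟨rfl, rfl⟩ := blackSquare_mem_dom.1 hb
    cases s <;> simp [hD]
  · rintro (⟨rfl, h⟩ | ⟨rfl, h⟩ | ⟨rfl, h⟩ | ⟨rfl, h⟩) <;>
      exact ⟨h, blackSquare_mem_dom.2 ⟨rfl, rfl⟩⟩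

theorem white_succ_iff (T : Finset (Finset Square)) (hT : ∀ D ∈ T, ∃ r j s, D = dom k r j s)
    (r j : ℕ) : (∃! D, D ∈ T ∧ whiteSquare k r (j + 1) ∈ D) ↔
      count (dom k r j Side.top ∈ T) + count (dom k (r + 1) j Side.right ∈ T) +
        (count (dom k r (j + 1) Side.left ∈ T) + count (dom k (r + 1) (j + 1) Side.bottom ∈ T)) =
          1 := by
  rw [← add_assoc, ← existsUnique_iff_count (a := dom k r j Side.top)
    (b := dom k (r + 1) j Side.right) (c := dom k r (j + 1) Side.left)
    (d := dom k (r + 1) (j + 1) Side.bottom)]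
  rotate_left
  iterate 6 exact fun h => by simpa using (dom_inj h).2.2
  refine existsUnique_congr fun D => ?_
  constructor
  · rintro ⟨hD, hb⟩
    obtain ⟨r', j', s, rfl⟩ := hT D hD
    rcases whiteSquare_mem_dom.1 hb with ⟨rfl, rfl, rfl⟩ | ⟨rfl, rfl, h⟩ | ⟨rfl, rfl, rfl⟩ |
      ⟨rfl, rfl, h⟩
    · simp [hD]
    · obtain rfl : j' = j := by omega
      simp [hD]
    · simp [hD]
    · obtain rfl : j' = j := by omega
      simp [hD]
  · rintro (⟨rfl, h⟩ | ⟨rfl, h⟩ | ⟨rfl, h⟩ | ⟨rfl, h⟩) <;>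
      exact ⟨h, whiteSquare_mem_dom.2 (by simp)⟩

theorem white_zero_iff (T : Finset (Finset Square)) (hT : ∀ D ∈ T, ∃ r j s, D = dom k r j s)
    (r : ℕ) : (∃! D, D ∈ T ∧ whiteSquare k r 0 ∈ D) ↔
      count (dom k r 0 Side.left ∈ T) + count (dom k (r + 1) 0 Side.bottom ∈ T) = 1 := by
  -- The white square in position `0` has no column on its left. Two `False` terms fill the four
  -- slots; the dominoes attached to them only have to be distinct from the others.
  have e : count (dom k r 0 Side.left ∈ T) + count (dom k (r + 1) 0 Side.bottom ∈ T) =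
      count (dom k r 0 Side.left ∈ T) + count (dom k (r + 1) 0 Side.bottom ∈ T) +
        count False + count False := by simp [count]
  rw [e, ← existsUnique_iff_count (a := dom k r 0 Side.left)
    (b := dom k (r + 1) 0 Side.bottom) (c := dom k r 0 Side.top) (d := dom k r 0 Side.right)]
  rotate_left
  iterate 6 exact fun h => by simpa using (dom_inj h).2.2
  refine existsUnique_congr fun D => ?_
  constructor
  · rintro ⟨hD, hb⟩
    obtain ⟨r', j', s, rfl⟩ := hT D hD
    rcases whiteSquare_mem_dom.1 hb with ⟨rfl, rfl, rfl⟩ | ⟨rfl, rfl, h⟩ | ⟨rfl, rfl, rfl⟩ |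
      ⟨rfl, rfl, h⟩
    · simp [hD]
    · omega
    · simp [hD]
    · omega
  · rintro (⟨rfl, h⟩ | ⟨rfl, h⟩ | ⟨rfl, h⟩ | ⟨rfl, h⟩)
    · exact ⟨h, whiteSquare_mem_dom.2 (by simp)⟩
    · exact ⟨h, whiteSquare_mem_dom.2 (by simp)⟩
    · exact h.elim
    · exact h.elim

theorem IsTiling.isLayout (hn : n + 1 = 2 * k + ε) (hε : ε ≤ 1) {T : Finset (Finset Square)}
    (h : IsTiling (diamond n) T) : IsLayout ε k fun r j s => dom k r j s ∈ T := by
  have hT (D) (hD : D ∈ T) : ∃ r j s, D = dom k r j s := by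
    obtain ⟨r, j, s, -, -, e⟩ := exists_dom hn hε (h.1 D hD).1 (h.1 D hD).2
    exact ⟨r, j, s, e⟩
  have hb {r j s} (hD : dom k r j s ∈ T) : IsBlack ε k r j :=
    (blackSquare_mem hn hε r j).1 ((h.1 _ hD).2 (by simp [dom]))
  exact
    { isBlack := hb
      hasNeighbor := fun hD =>
        (neighbor_mem hn hε (hb hD) _).1 ((h.1 _ hD).2 (by simp [dom]))
      black := fun hr => (black_iff T hT _ _).1 (h.2 _ ((blackSquare_mem hn hε _ _).2 hr))
      white_zero := fun hr => (white_zero_iff T hT _).1 (h.2 _ ((whiteSquare_mem hn hε _ _).2 hr))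
      white_succ := fun hr =>
        (white_succ_iff T hT _ _).1 (h.2 _ ((whiteSquare_mem hn hε _ _).2 hr)) }

noncomputable instance : DecidableEq Side := Classical.decEq _

noncomputable instance : Fintype Side :=
  ⟨{Side.left, Side.right, Side.top, Side.bottom}, fun s => by cases s <;> simp⟩

open Classical in
theorem IsLayout.exists_isTiling (hn : n + 1 = 2 * k + ε) (hε : ε ≤ 1) {H : ℕ → ℕ → Side → Prop}
    (h : IsLayout ε k H) : ∃ T : Finset (Finset Square), IsTiling (diamond n) T ∧
      ∀ r j s, dom k r j s ∈ T ↔ H r j s := by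
  set T : Finset (Finset Square) := ((Finset.range (2 * k + 1) ×ˢ Finset.range (2 * k) ×ˢ
    (Finset.univ : Finset Side)).filter (fun x => H x.1 x.2.1 x.2.2)).image
      fun x => dom k x.1 x.2.1 x.2.2 with hTdef
  have hmem (r j s) : dom k r j s ∈ T ↔ H r j s := by
    rw [hTdef, Finset.mem_image]
    constructor
    · rintro ⟨⟨r', j', s'⟩, hx, e⟩
      obtain ⟨rfl, rfl, rfl⟩ := dom_inj e
      exact (Finset.mem_filter.1 hx).2
    · intro hH
      have := h.isBlack hH
      simp only [IsBlack] at this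
      refine ⟨(r, j, s), Finset.mem_filter.2 ⟨?_, hH⟩, rfl⟩
      simp only [Finset.mem_product, Finset.mem_range, Finset.mem_univ, and_true]
      omega
  have hT (D) (hD : D ∈ T) : ∃ r j s, D = dom k r j s := by
    obtain ⟨x, -, rfl⟩ := Finset.mem_image.1 hD
    exact ⟨_, _, _, rfl⟩
  refine ⟨T, ⟨fun D hD => ?_, fun p hp => ?_⟩, hmem⟩
  · obtain ⟨r, j, s, rfl⟩ := hT D hD
    have hH := (hmem r j s).1 hD
    refine ⟨⟨_, _, rfl⟩, ?_⟩
    intro p hp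
    rw [Finset.mem_coe, dom, Finset.mem_insert, Finset.mem_singleton] at hp
    rcases hp with rfl | rfl
    · exact (blackSquare_mem hn hε r j).2 (h.isBlack hH)
    · exact (neighbor_mem hn hε (h.isBlack hH) s).2 (h.hasNeighbor hH)
  · rcases exists_index hn hε hp with ⟨r, j, hb, rfl⟩ | ⟨r, j, hw, rfl⟩
    · rw [black_iff T hT]
      simpa only [hmem] using h.black hb
    · cases j with
      | zero =>
        rw [white_zero_iff T hT]
        simpa only [hmem] using h.white_zero hw
      | succ j =>
        rw [white_succ_iff T hT]
        simpa only [hmem] using h.white_succ hw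

/-- Domino tilings correspond to layouts. -/
theorem ncard_tilings_eq (hn : n + 1 = 2 * k + ε) (hε : ε ≤ 1) (d : ℕ → Decision) :
    Set.ncard {T : Finset (Finset Square) | IsTiling (diamond n) T ∧ Compatible T (barriers k d)} =
      Set.ncard {H : ℕ → ℕ → Side → Prop | IsLayout ε k H ∧
        ∀ j < 2 * k, ∀ s ∈ (d (j + 1)).sides, ¬ H k j s} := by
  have hspine (i : ℕ) (hi : 1 ≤ i) : spineSquare k i = blackSquare k k (i - 1) := by
    simp only [spineSquare, blackSquare, Prod.mk.injEq]
    omega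
  have hcompat {T : Finset (Finset Square)} : Compatible T (barriers k d) ↔
      ∀ j < 2 * k, ∀ s ∈ (d (j + 1)).sides, ¬ dom k k j s ∈ T := by
    constructor
    · intro h j hj s hs hD
      refine h _ hD (spineSquare k (j + 1), s)
        ⟨j + 1, Finset.mem_Icc.2 ⟨by omega, by omega⟩, rfl, hs⟩ ?_
      rw [Crosses, hspine _ (by omega), Nat.add_sub_cancel]
      rfl
    · rintro h D hD ⟨p, s⟩ ⟨i, hi, rfl, hs⟩ hc
      rw [Finset.mem_Icc] at hi
      simp only [Crosses, hspine i hi.1] at hc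
      rw [hc] at hD
      refine h (i - 1) (by omega) s ?_ hD
      rwa [Nat.sub_add_cancel hi.1]
  refine Set.ncard_congr (fun T _ r j s => dom k r j s ∈ T) ?_ ?_ ?_
  · rintro T ⟨h1, h2⟩
    exact ⟨h1.isLayout hn hε, hcompat.1 h2⟩
  · rintro T T' ⟨h1, -⟩ ⟨h1', -⟩ e
    have key {T T' : Finset (Finset Square)} (h1 : IsTiling (diamond n) T)
        (e : ∀ r j s, dom k r j s ∈ T → dom k r j s ∈ T') : T ⊆ T' := by
      intro D hD
      obtain ⟨r, j, s, -, -, rfl⟩ := exists_dom hn hε (h1.1 D hD).1 (h1.1 D hD).2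
      exact e r j s hD
    have e' (r j s) : (dom k r j s ∈ T) = (dom k r j s ∈ T') :=
      congrFun (congrFun (congrFun e r) j) s
    exact (key h1 fun r j s h => e' r j s ▸ h).antisymm (key h1' fun r j s h => (e' r j s).symm ▸ h)
  · rintro H ⟨h1, h2⟩
    obtain ⟨T, hT, hmem⟩ := h1.exists_isTiling hn hε
    refine ⟨T, ⟨hT, hcompat.2 fun j hj s hs => ?_⟩, ?_⟩
    · rw [hmem]
      exact h2 j hj s hs
    · ext r j s
      exact hmem r j s

end Aztec

/-! ### Layouts and their codes. -/

namespace Aztec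

variable {k ε : ℕ} {H : ℕ → ℕ → Side → Prop}

theorem count_of {p : Prop} (h : p) : count p = 1 := if_pos h

theorem count_of_not {p : Prop} (h : ¬ p) : count p = 0 := if_neg h

theorem count_eq_ite (p : Prop) [Decidable p] : count p = if p then 1 else 0 := by
  unfold count
  congr

theorem IsLayout.existsUnique (h : IsLayout ε k H) {r j : ℕ} (hb : IsBlack ε k r j) :
    ∃! s, H r j s := by
  have h1 := h.black hb
  rw [← existsUnique_iff_count (a := Side.left) (b := Side.top) (c := Side.bottom)
    (d := Side.right)] at h1
  rotate_left
  iterate 6 exact nofun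
  refine (existsUnique_congr fun s => ?_).1 h1
  cases s <;> simp

theorem IsLayout.eq (h : IsLayout ε k H) {r j : ℕ} {s s' : Side} (hs : H r j s)
    (hs' : H r j s') : s = s' :=
  (h.existsUnique (h.isBlack hs)).unique hs hs'

open Classical in
/-- The columns of the `r`-th row of black squares whose dominoes go up. -/
noncomputable def upSet (ε k : ℕ) (H : ℕ → ℕ → Side → Prop) (r : ℕ) : Finset ℕ :=
  if r = 0 then Finset.range (2 * k) \ topSet ε (2 * k) else
    if r = 2 * k then topSet ε (2 * k) else
      {j ∈ Finset.range (2 * k) | H r j Side.left ∨ H r j Side.top}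

open Classical in
/-- The columns in which a domino goes up and left from the `r`-th row of black squares. -/
noncomputable def lowSet (k : ℕ) (H : ℕ → ℕ → Side → Prop) (r : ℕ) : Finset ℕ :=
  {j ∈ Finset.range (2 * k) | H r j Side.left}

open Classical in
/-- The columns in which a domino goes down and left to the `r`-th row of white squares. -/
noncomputable def highSet (k : ℕ) (H : ℕ → ℕ → Side → Prop) (r : ℕ) : Finset ℕ :=
  {j ∈ Finset.range (2 * k) | H (r + 1) j Side.bottom}

theorem topSet_subset (ε N : ℕ) : topSet ε N ⊆ Finset.range N := by
  rw [topSet]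
  split_ifs <;> simp

theorem upSet_subset (ε k : ℕ) (H : ℕ → ℕ → Side → Prop) (r : ℕ) :
    upSet ε k H r ⊆ Finset.range (2 * k) := by
  classical
  rw [upSet]
  split_ifs
  · exact Finset.sdiff_subset
  · exact topSet_subset _ _
  · exact Finset.filter_subset _ _

/-- Only row `0` needs an argument. For `ε = 0` it is fictitious and `upSet` is empty there; for `ε
= 1` its squares have no white neighbor below, so every domino goes up. The next lemma is the mirror
image at row `2 * k`. -/
theorem IsLayout.mem_upSet (h : IsLayout ε k H) (hε : ε ≤ 1) {r j : ℕ} (hr : r < 2 * k)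
    (hj : j < 2 * k) : j ∈ upSet ε k H r ↔ H r j Side.left ∨ H r j Side.top := by
  rw [upSet]
  split_ifs with h0 h1
  · subst h0
    interval_cases ε
    · simp only [topSet, zero_ne_one, if_false, sdiff_self, Finset.bot_eq_empty,
        Finset.notMem_empty, false_iff]
      rintro (h' | h') <;>
      · have := h.isBlack h'
        simp only [IsBlack] at this
        omega
    · simp only [topSet, if_true, Finset.sdiff_empty, Finset.mem_range, hj, true_iff]
      obtain ⟨s, hs, -⟩ := h.existsUnique (r := 0) (j := j)
        (by simp only [IsBlack]; omega)
      have := h.hasNeighbor hs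
      cases s <;> simp_all [HasNeighbor]
  · omega
  · simp [hj]

theorem IsLayout.notMem_upSet (h : IsLayout ε k H) (hε : ε ≤ 1) {r j : ℕ} (hr : r < 2 * k)
    (hj : j < 2 * k) :
    j ∉ upSet ε k H (r + 1) ↔ H (r + 1) j Side.bottom ∨ H (r + 1) j Side.right := by
  rw [upSet, if_neg (Nat.succ_ne_zero r)]
  split_ifs with h1
  · interval_cases ε
    · simp only [topSet, zero_ne_one, if_false, Finset.mem_range, hj, not_true, false_iff]
      rintro (h' | h') <;>
      · have := h.isBlack h'
        simp only [IsBlack] at this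
        omega
    · simp only [topSet, if_true, Finset.notMem_empty, not_false_iff, true_iff]
      obtain ⟨s, hs, -⟩ := h.existsUnique (r := r + 1) (j := j)
        (by simp only [IsBlack]; omega)
      have := h.hasNeighbor hs
      cases s <;> simp_all [HasNeighbor, IsWhite]
  · simp only [Finset.mem_filter, Finset.mem_range, hj, true_and]
    obtain ⟨s, hs, hu⟩ := h.existsUnique (r := r + 1) (j := j)
        (by simp only [IsBlack]; omega)
    have h' (s') : H (r + 1) j s' ↔ s' = s := ⟨hu s', fun e => e ▸ hs⟩
    simp only [h']
    cases s <;> simp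

theorem IsLayout.leftCount_eq (h : IsLayout ε k H) (r j : ℕ) :
    leftCount (lowSet k H r) (highSet k H r) j =
      count (H r j Side.left) + count (H (r + 1) j Side.bottom) := by
  have h1 {r s} (hs : H r j s) : j < 2 * k := (h.isBlack hs).1
  have e1 : j ∈ lowSet k H r ↔ H r j Side.left := by
    simpa [lowSet] using h1
  have e2 : j ∈ highSet k H r ↔ H (r + 1) j Side.bottom := by
    simpa [highSet] using h1
  rw [leftCount, ← count_eq_ite, ← count_eq_ite, e1, e2]

theorem IsLayout.rightCount_eq (h : IsLayout ε k H) (hε : ε ≤ 1) {r j : ℕ} (hr : r < 2 * k)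
    (hj : j < 2 * k) :
    rightCount (upSet ε k H r) (upSet ε k H (r + 1)) (lowSet k H r) (highSet k H r) j =
      count (H r j Side.top) + count (H (r + 1) j Side.right) := by
  have e1 : j ∈ upSet ε k H r ∧ j ∉ lowSet k H r ↔ H r j Side.top := by
    rw [h.mem_upSet hε hr hj, lowSet]
    simp only [Finset.mem_filter, Finset.mem_range, hj, true_and]
    refine ⟨by tauto, fun h1 => ⟨Or.inr h1, fun h2 => nomatch h.eq h1 h2⟩⟩
  have e2 : j ∉ upSet ε k H (r + 1) ∧ j ∉ highSet k H r ↔ H (r + 1) j Side.right := by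
    rw [h.notMem_upSet hε hr hj, highSet]
    simp only [Finset.mem_filter, Finset.mem_range, hj, true_and]
    refine ⟨by tauto, fun h1 => ⟨Or.inr h1, fun h2 => nomatch h.eq h1 h2⟩⟩
  rw [rightCount, ← count_eq_ite, ← count_eq_ite, e1, e2]

theorem IsLayout.mem_rowSet (h : IsLayout ε k H) (hε : ε ≤ 1) {r : ℕ} (hr : r < 2 * k) :
    (lowSet k H r, highSet k H r) ∈
      rowSet ε (2 * k) (upSet ε k H r) (upSet ε k H (r + 1)) := by
  simp only [rowSet, Finset.mem_filter, Finset.mem_product, Finset.mem_powerset]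
  refine ⟨⟨fun j hj => ?_, fun j hj => ?_⟩, ?_⟩
  · simp only [lowSet, Finset.mem_filter, Finset.mem_range] at hj
    exact (h.mem_upSet hε hr hj.1).2 (Or.inl hj.2)
  · simp only [highSet, Finset.mem_filter, Finset.mem_range] at hj
    exact Finset.mem_sdiff.2 ⟨Finset.mem_range.2 hj.1,
      (h.notMem_upSet hε hr hj.1).2 (Or.inl hj.2)⟩
  · have hfits := (fits_succ_iff ε (upSet ε k H r) (upSet ε k H (r + 1)) (lowSet k H r)
      (highSet k H r) (2 * k - 1) (1 - ε)).2 ?_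
    · rwa [Nat.sub_add_cancel (by omega)] at hfits
    refine ⟨?_, fun i hi => ?_, ?_⟩
    · rw [h.leftCount_eq]
      interval_cases ε
      · rw [count_of_not, count_of_not]
        · intro h'
          have := h.hasNeighbor h'
          simp only [HasNeighbor, IsWhite] at this
          omega
        · intro h'
          have := h.hasNeighbor h'
          simp only [HasNeighbor, IsWhite] at this
          omega
      · exact h.white_zero (by simp only [IsWhite]; omega)
    · rw [h.leftCount_eq, h.rightCount_eq hε hr (by omega)]
      exact h.white_succ (by simp only [IsWhite]; omega)
    · rw [h.rightCount_eq hε hr (by omega)]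
      interval_cases ε
      · rw [count_of_not, count_of_not]
        · intro h'
          have := h.hasNeighbor h'
          simp only [HasNeighbor, IsWhite] at this
          omega
        · intro h'
          have := h.hasNeighbor h'
          simp only [HasNeighbor, IsWhite] at this
          omega
      -- The rightmost white square has no black column on its right, so two of its four terms
      -- vanish.
      · have := h.white_succ (r := r) (j := 2 * k - 1) (by simp only [IsWhite]; omega)
        rw [count_of_not (p := H r (2 * k - 1 + 1) Side.left),
          count_of_not (p := H (r + 1) (2 * k - 1 + 1) Side.bottom)] at this
        · exact this
        · intro h'
          have := h.isBlack h'
          simp only [IsBlack] at this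
          omega
        · intro h'
          have := h.isBlack h'
          simp only [IsBlack] at this
          omega

/-- The layout that is described by the sets of columns whose dominoes go up, up and left, or down
and left. -/
def decode (ε k : ℕ) (u L L' : ℕ → Finset ℕ) (r j : ℕ) : Side → Prop
  | Side.left => IsBlack ε k r j ∧ j ∈ u r ∧ j ∈ L r
  | Side.top => IsBlack ε k r j ∧ j ∈ u r ∧ j ∉ L r
  | Side.bottom => IsBlack ε k r j ∧ j ∉ u r ∧ j ∈ L' (r - 1)
  | Side.right => IsBlack ε k r j ∧ j ∉ u r ∧ j ∉ L' (r - 1)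

section Decode

variable {u L L' : ℕ → Finset ℕ}

theorem isBlack_of_mem (hε : ε ≤ 1) (h0 : u 0 = Finset.range (2 * k) \ topSet ε (2 * k)) {r j : ℕ}
    (hr : r < 2 * k) (hj : j < 2 * k) (hu : j ∈ u r) : IsBlack ε k r j := by
  refine ⟨hj, hr.le, ?_, by omega⟩
  by_contra hlt
  obtain ⟨rfl, rfl⟩ : r = 0 ∧ ε = 0 := by omega
  simp [h0, topSet] at hu

theorem isBlack_of_notMem (hε : ε ≤ 1) (h1 : u (2 * k) = topSet ε (2 * k)) {r j : ℕ}
    (hr : r < 2 * k) (hj : j < 2 * k) (hu : j ∉ u (r + 1)) : IsBlack ε k (r + 1) j := by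
  refine ⟨hj, hr, by omega, ?_⟩
  by_contra hlt
  obtain ⟨hr, rfl⟩ : r + 1 = 2 * k ∧ ε = 0 := by omega
  rw [hr, h1] at hu
  simp [topSet, hj] at hu

theorem decode_left_iff (hε : ε ≤ 1) (h0 : u 0 = Finset.range (2 * k) \ topSet ε (2 * k)) {r j : ℕ}
    (hr : r < 2 * k) (hj : j < 2 * k) (hL : L r ⊆ u r) :
    decode ε k u L L' r j Side.left ↔ j ∈ L r :=
  ⟨fun h => h.2.2, fun h => ⟨isBlack_of_mem hε h0 hr hj (hL h), hL h, h⟩⟩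

theorem decode_top_iff (hε : ε ≤ 1) (h0 : u 0 = Finset.range (2 * k) \ topSet ε (2 * k)) {r j : ℕ}
    (hr : r < 2 * k) (hj : j < 2 * k) :
    decode ε k u L L' r j Side.top ↔ j ∈ u r ∧ j ∉ L r :=
  ⟨fun h => h.2, fun h => ⟨isBlack_of_mem hε h0 hr hj h.1, h⟩⟩

theorem decode_bottom_iff (hε : ε ≤ 1) (h1 : u (2 * k) = topSet ε (2 * k)) {r j : ℕ}
    (hr : r < 2 * k) (hj : j < 2 * k) (hL' : L' r ⊆ Finset.range (2 * k) \ u (r + 1)) :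
    decode ε k u L L' (r + 1) j Side.bottom ↔ j ∈ L' r :=
  ⟨fun h => h.2.2, fun h => by
    have hu := (Finset.mem_sdiff.1 (hL' h)).2
    exact ⟨isBlack_of_notMem hε h1 hr hj hu, hu, h⟩⟩

theorem decode_right_iff (hε : ε ≤ 1) (h1 : u (2 * k) = topSet ε (2 * k)) {r j : ℕ}
    (hr : r < 2 * k) (hj : j < 2 * k) :
    decode ε k u L L' (r + 1) j Side.right ↔ j ∉ u (r + 1) ∧ j ∉ L' r :=
  ⟨fun h => h.2, fun h => ⟨isBlack_of_notMem hε h1 hr hj h.1, h⟩⟩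

theorem isBlack_of_decode {r j : ℕ} {s : Side} (h : decode ε k u L L' r j s) :
    IsBlack ε k r j := by
  cases s <;> exact h.1

theorem decode_black {r j : ℕ} (h : IsBlack ε k r j) :
    count (decode ε k u L L' r j Side.left) + count (decode ε k u L L' r j Side.top) +
      count (decode ε k u L L' r j Side.bottom) + count (decode ε k u L L' r j Side.right) = 1 := by
  by_cases hu : j ∈ u r <;> by_cases hL : j ∈ L r <;> by_cases hL' : j ∈ L' (r - 1) <;>
    simp [decode, count, h, hu, hL, hL']

theorem isLayout_decode (hε : ε ≤ 1) (h0 : u 0 = Finset.range (2 * k) \ topSet ε (2 * k))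
    (h1 : u (2 * k) = topSet ε (2 * k))
    (hrow : ∀ r < 2 * k, (L r, L' r) ∈ rowSet ε (2 * k) (u r) (u (r + 1))) :
    IsLayout ε k (decode ε k u L L') := by
  have hL (r) (hr : r < 2 * k) : L r ⊆ u r := by
    have := hrow r hr
    simp only [rowSet, Finset.mem_filter, Finset.mem_product, Finset.mem_powerset] at this
    exact this.1.1
  have hL' (r) (hr : r < 2 * k) : L' r ⊆ Finset.range (2 * k) \ u (r + 1) := by
    have := hrow r hr
    simp only [rowSet, Finset.mem_filter, Finset.mem_product, Finset.mem_powerset] at this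
    exact this.1.2
  have hfits (r) (hr : r < 2 * k) := (fits_succ_iff ε (u r) (u (r + 1)) (L r) (L' r) (2 * k - 1)
      (1 - ε)).1 (by
    have := hrow r hr
    simp only [rowSet, Finset.mem_filter] at this
    rw [Nat.sub_add_cancel (by omega)]
    exact this.2)
  have hleft (r j) (hr : r < 2 * k) (hj : j < 2 * k) : count (decode ε k u L L' r j Side.left) +
      count (decode ε k u L L' (r + 1) j Side.bottom) = leftCount (L r) (L' r) j := by
    rw [decode_left_iff hε h0 hr hj (hL r hr), decode_bottom_iff hε h1 hr hj (hL' r hr), leftCount,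
      ← count_eq_ite, ← count_eq_ite]
  have hright (r j) (hr : r < 2 * k) (hj : j < 2 * k) : count (decode ε k u L L' r j Side.top) +
      count (decode ε k u L L' (r + 1) j Side.right) =
        rightCount (u r) (u (r + 1)) (L r) (L' r) j := by
    rw [decode_top_iff hε h0 hr hj, decode_right_iff hε h1 hr hj, rightCount,
      ← count_eq_ite, ← count_eq_ite]
  have not_of_count {p : Prop} (h : count p = 0) : ¬ p := fun hp => by simp [count_of hp] at h
  refine ⟨isBlack_of_decode, fun {r j s} h => ?_, decode_black, fun {r} hw => ?_,
    fun {r j} hw => ?_⟩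
  · have hb := isBlack_of_decode h
    have hb' := hb
    simp only [IsBlack] at hb'
    have hup (hu : j ∈ u r) : r < 2 * k := by
      by_contra hlt
      obtain ⟨rfl, rfl⟩ : r = 2 * k ∧ ε = 1 := by omega
      simp [h1, topSet] at hu
    have hdown (hu : j ∉ u r) : 1 ≤ r := by
      by_contra hlt
      obtain ⟨rfl, rfl⟩ : r = 0 ∧ ε = 1 := by omega
      simp [h0, topSet, hb'.1] at hu
    -- For `ε = 0` the white squares at both ends are missing. The end conditions of `Fits` make the
    -- corresponding counts zero, so no domino leaves the diamond there.
    have hleft0 (r) (hr : r < 2 * k) (hj : j = 0) (hε0 : ε = 0) :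
        ¬ decode ε k u L L' r j Side.left ∧ ¬ decode ε k u L L' (r + 1) j Side.bottom := by
      have e := hleft r j hr hb'.1
      rw [hj, (hfits r hr).1, ← hj] at e
      exact ⟨not_of_count (by omega), not_of_count (by omega)⟩
    have hright0 (r) (hr : r < 2 * k) (hj : j = 2 * k - 1) (hε0 : ε = 0) :
        ¬ decode ε k u L L' r j Side.top ∧ ¬ decode ε k u L L' (r + 1) j Side.right := by
      have e := hright r j hr hb'.1
      have e' := (hfits r hr).2.2
      rw [← hj, ← e] at e'
      exact ⟨not_of_count (by omega), not_of_count (by omega)⟩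
    cases s <;> simp only [HasNeighbor, IsWhite]
    · have hr := hup h.2.1
      refine ⟨hr, by omega, ?_, by omega⟩
      by_contra hlt
      exact (hleft0 r hr (by omega) (by omega)).1 h
    · have hr := hdown h.2.1
      refine ⟨hr, by omega, by omega, by omega, ?_⟩
      by_contra hlt
      have := (hright0 (r - 1) (by omega) (by omega) (by omega)).2
      rw [Nat.sub_add_cancel hr] at this
      exact this h
    · have hr := hup h.2.1
      refine ⟨hr, by omega, by omega, ?_⟩
      by_contra hlt
      exact (hright0 r hr (by omega) (by omega)).1 h
    · have hr := hdown h.2.1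
      refine ⟨hr, by omega, by omega, ?_, by omega⟩
      by_contra hlt
      have := (hleft0 (r - 1) (by omega) (by omega) (by omega)).2
      rw [Nat.sub_add_cancel hr] at this
      exact this h
  · simp only [IsWhite] at hw
    rw [hleft r 0 hw.1 (by omega), (hfits r hw.1).1]
    omega
  · simp only [IsWhite] at hw
    rw [hright r j hw.1 (by omega)]
    by_cases hj : j + 1 < 2 * k
    · rw [hleft r (j + 1) hw.1 hj]
      exact (hfits r hw.1).2.1 j (by omega)
    · have hnot (r s) : ¬ decode ε k u L L' r (j + 1) s := fun h => by
        have := isBlack_of_decode h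
        simp only [IsBlack] at this
        omega
      have e := (hfits r hw.1).2.2
      obtain rfl : j = 2 * k - 1 := by omega
      rw [count_of_not (hnot _ _), count_of_not (hnot _ _)]
      omega

theorem upSet_decode (h0 : u 0 = Finset.range (2 * k) \ topSet ε (2 * k))
    (h1 : u (2 * k) = topSet ε (2 * k)) {r : ℕ} (hr : r ≤ 2 * k)
    (hu : u r ⊆ Finset.range (2 * k)) : upSet ε k (decode ε k u L L') r = u r := by
  classical
  rw [upSet]
  split_ifs with hr0 hr1
  · rw [hr0, h0]
  · rw [hr1, h1]
  · ext j
    rw [Finset.mem_filter, Finset.mem_range]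
    constructor
    · rintro ⟨-, h | h⟩
      · exact h.2.1
      · exact h.2.1
    · intro h
      have hj := Finset.mem_range.1 (hu h)
      have hb : IsBlack ε k r j := by
        simp only [IsBlack]
        omega
      refine ⟨hj, ?_⟩
      by_cases hjL : j ∈ L r
      · exact Or.inl ⟨hb, h, hjL⟩
      · exact Or.inr ⟨hb, h, hjL⟩

end Decode

/-- Layouts in which the dominoes on the spine respect `z` correspond to codes. -/
theorem ncard_layouts_eq (hε : ε ≤ 1) (hk : 0 < k) (z : ℕ → Prop) :
    Set.ncard {H : ℕ → ℕ → Side → Prop | IsLayout ε k H ∧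
      ∀ j < k, 2 * j + 1 ∈ upSet ε k H k ↔ z j} = (codes ε k z).card := by
  classical
  rw [← Set.ncard_coe_finset]
  refine Set.ncard_congr (fun H _ => ⟨fun r => ⟨upSet ε k H r,
    Finset.mem_powerset.2 (upSet_subset ε k H r)⟩, fun r => (lowSet k H r, highSet k H r)⟩) ?_ ?_ ?_
  · rintro H ⟨h, hz⟩
    rw [Finset.mem_coe, codes, Finset.mem_sigma, Finset.mem_filter, Fintype.mem_piFinset]
    refine ⟨⟨Finset.mem_univ _, ?_, hz, ?_⟩, fun r => ?_⟩
    · simp only [upSet, Fin.val_zero, if_true]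
      exact Finset.sdiff_sdiff_eq_self (topSet_subset _ _)
    · simp only [upSet, Fin.val_last, if_neg (show ¬ 2 * k = 0 by omega), if_true]
    · exact h.mem_rowSet hε r.2
  · rintro H H' ⟨h, -⟩ ⟨h', -⟩ e
    simp only [Sigma.mk.injEq, heq_eq_eq, funext_iff, Subtype.mk.injEq, Prod.mk.injEq] at e
    obtain ⟨e1, e2⟩ := e
    -- The directions left and bottom are recorded in the code; top and right are recovered by
    -- elimination, once it is known whether the domino goes up or down.
    have key {H H'} (h : IsLayout ε k H) (h' : IsLayout ε k H')
        (e1 : ∀ r : Fin (2 * k + 1), upSet ε k H r = upSet ε k H' r)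
        (e2 : ∀ r : Fin (2 * k), lowSet k H r = lowSet k H' r ∧ highSet k H r = highSet k H' r)
        {r j s} (hs : H r j s) : H' r j s := by
      have hj := (h.isBlack hs).1
      have hn := h.hasNeighbor hs
      have hlow (r) (hr : r < 2 * k) : H r j Side.left ↔ H' r j Side.left := by
        have := congrArg (j ∈ ·) (e2 ⟨r, hr⟩).1
        simpa [lowSet, hj] using this
      have hhigh (r) (hr : r < 2 * k) : H (r + 1) j Side.bottom ↔ H' (r + 1) j Side.bottom := by
        have := congrArg (j ∈ ·) (e2 ⟨r, hr⟩).2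
        simpa [highSet, hj] using this
      have hup (r) (hr : r < 2 * k + 1) : j ∈ upSet ε k H r ↔ j ∈ upSet ε k H' r := by
        rw [e1 ⟨r, hr⟩]
      cases s
      · exact (hlow r hn.1).1 hs
      · obtain ⟨r, rfl⟩ : ∃ l, r = l + 1 := ⟨r - 1, by have := hn.1; omega⟩
        have hr : r < 2 * k := hn.2.1
        rcases (h'.notMem_upSet hε hr hj).1 fun h1 => (h.notMem_upSet hε hr hj).2 (Or.inr hs)
          ((hup (r + 1) (by omega)).2 h1) with h1 | h1
        · exact nomatch h.eq hs ((hhigh r hr).2 h1)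
        · exact h1
      · have hr : r < 2 * k := hn.1
        rcases (h'.mem_upSet hε hr hj).1 ((hup r (by omega)).1
          ((h.mem_upSet hε hr hj).2 (Or.inr hs))) with h1 | h1
        · exact nomatch h.eq hs ((hlow r hr).2 h1)
        · exact h1
      · obtain ⟨r, rfl⟩ : ∃ l, r = l + 1 := ⟨r - 1, by have := hn.1; omega⟩
        exact (hhigh r hn.2.1).1 hs
    ext r j s
    exact ⟨key h h' e1 e2, key h' h (fun r => (e1 r).symm)
      fun r => ⟨(e2 r).1.symm, (e2 r).2.symm⟩⟩
  · rintro ⟨U, G⟩ hc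
    rw [Finset.mem_coe, codes, Finset.mem_sigma, Finset.mem_filter, Fintype.mem_piFinset] at hc
    obtain ⟨⟨-, hU0, hz, hU1⟩, hG⟩ := hc
    dsimp only at hU0 hz hU1 hG
    set u : ℕ → Finset ℕ := fun r => if h : r < 2 * k + 1 then U ⟨r, h⟩ else ∅ with hu
    set L : ℕ → Finset ℕ := fun r => if h : r < 2 * k then (G ⟨r, h⟩).1 else ∅ with hL
    set L' : ℕ → Finset ℕ := fun r => if h : r < 2 * k then (G ⟨r, h⟩).2 else ∅ with hL'
    have hUsub (r) : (U r : Finset ℕ) ⊆ Finset.range (2 * k) := Finset.mem_powerset.1 (U r).2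
    have hu' (r : Fin (2 * k + 1)) : u r = U r := by
      simp only [hu, dif_pos r.2]
    have h0 : u 0 = Finset.range (2 * k) \ topSet ε (2 * k) := by
      rw [← hU0, Finset.sdiff_sdiff_eq_self (hUsub 0)]
      exact hu' 0
    have h1 : u (2 * k) = topSet ε (2 * k) := by
      rw [← hU1]
      exact hu' (Fin.last (2 * k))
    have hrow (r) (hr : r < 2 * k) : (L r, L' r) ∈ rowSet ε (2 * k) (u r) (u (r + 1)) := by
      have := hG ⟨r, hr⟩
      simp only [hL, hL', dif_pos hr]
      exact (hu' (Fin.castSucc ⟨r, hr⟩)).symm ▸ (hu' (Fin.succ ⟨r, hr⟩)).symm ▸ this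
    have hrow' (r) (hr : r < 2 * k) := hrow r hr
    simp only [rowSet, Finset.mem_filter, Finset.mem_product, Finset.mem_powerset] at hrow'
    have hup (r : Fin (2 * k + 1)) : upSet ε k (decode ε k u L L') r = U r := by
      rw [upSet_decode h0 h1 (by omega) (by rw [hu']; exact hUsub r), hu']
    refine ⟨decode ε k u L L', ⟨isLayout_decode hε h0 h1 hrow, fun j hj => ?_⟩, ?_⟩
    · rw [← hz j hj, hup ⟨k, by omega⟩]
    · simp only [Sigma.mk.injEq, heq_eq_eq]
      refine ⟨funext fun r => Subtype.ext (hup r), funext fun r => Prod.ext ?_ ?_⟩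
      · have hLr : L r = (G r).1 := by simp [hL]
        rw [← hLr]
        ext j
        simp only [lowSet, Finset.mem_filter, Finset.mem_range]
        have hs := (hrow' r r.2).1.1
        constructor
        · exact fun h => h.2.2.2
        · intro hj
          have hj' : j < 2 * k :=
            Finset.mem_range.1 (hUsub r.castSucc (hu' r.castSucc ▸ hs hj))
          exact ⟨hj', (decode_left_iff hε h0 r.2 hj' hs).2 hj⟩
      · have hLr : L' r = (G r).2 := by simp [hL']
        rw [← hLr]
        ext j
        simp only [highSet, Finset.mem_filter, Finset.mem_range]
        have hs := (hrow' r r.2).1.2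
        constructor
        · exact fun h => h.2.2.2
        · intro hj
          have hj' : j < 2 * k := Finset.mem_range.1 (Finset.mem_sdiff.1 (hs hj)).1
          exact ⟨hj', (decode_bottom_iff hε h1 r.2 hj' hs).2 hj⟩

end Aztec

/-! ### The final count. -/

theorem theorem1 (n k : ℕ) (hk : k = ⌈(n : ℚ) / 2⌉₊) (d : ℕ → Aztec.Decision)
    (hodd : ∀ i ∈ Finset.Icc 1 (2 * k), Odd i → d i = Aztec.Decision.zip)
    (heven : ∀ i ∈ Finset.Icc 1 (2 * k), Even i →
      d i = Aztec.Decision.zig ∨ d i = Aztec.Decision.zag) :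
    (Set.ncard {T : Finset (Finset Aztec.Square) | Aztec.IsTiling (Aztec.diamond n) T ∧
        Aztec.Compatible T (Aztec.barriers k d)} : ℚ) =
      2 ^ (n * (n + 1) / 2) / 2 ^ k := by
  obtain ⟨ε, hε, hn⟩ : ∃ ε ≤ 1, n + 1 = 2 * k + ε := by
    have h1 : (n : ℚ) / 2 ≤ k := hk ▸ Nat.le_ceil _
    have h2 : (k : ℚ) < n / 2 + 1 := hk ▸ Nat.ceil_lt_add_one (by positivity)
    have h3 : n ≤ 2 * k := by
      have : (n : ℚ) ≤ (2 * k : ℕ) := by push_cast; linarith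
      exact_mod_cast this
    have h4 : 2 * k < n + 2 := by
      have : ((2 * k : ℕ) : ℚ) < (n + 2 : ℕ) := by push_cast; linarith
      exact_mod_cast this
    exact ⟨n + 1 - 2 * k, by omega, by omega⟩
  rcases Nat.eq_zero_or_pos k with rfl | hk0
  · obtain rfl : n = 0 := by omega
    have hempty : Aztec.diamond 0 = ∅ := by
      ext ⟨x, y⟩
      simp only [Aztec.diamond, Set.mem_ofPred_eq, Set.mem_empty_iff_false, iff_false]
      rcases abs_cases (2 * x + 1) with h1 | h1 <;> rcases abs_cases (2 * y + 1) with h2 | h2 <;>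
        push_cast <;> omega
    have hset : {T : Finset (Finset Aztec.Square) | Aztec.IsTiling (Aztec.diamond 0) T ∧
        Aztec.Compatible T (Aztec.barriers 0 d)} = {∅} := by
      ext T
      simp only [Set.mem_ofPred_eq, Set.mem_singleton_iff, hempty]
      constructor
      · rintro ⟨⟨h, -⟩, -⟩
        refine Finset.eq_empty_of_forall_notMem fun D hD => ?_
        obtain ⟨⟨p, s, rfl⟩, hsub⟩ := h D hD
        exact hsub (show p ∈ _ by simp)
      · rintro rfl
        exact ⟨⟨by simp, by simp⟩, by simp [Aztec.Compatible]⟩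
    rw [hset, Set.ncard_singleton]
    norm_num
  -- Spine square `2j + 2` sits in column `2j + 1`. A zig leaves only left and top, which means up;
  -- a zag leaves only bottom and right, which means down.
  have hdecision (j : ℕ) (hj : j < k) (H : ℕ → ℕ → Aztec.Side → Prop)
      (h : Aztec.IsLayout ε k H) : (∀ s ∈ (d (2 * j + 1 + 1)).sides, ¬ H k (2 * j + 1) s) ↔
        (2 * j + 1 ∈ Aztec.upSet ε k H k ↔ d (2 * j + 1 + 1) = Aztec.Decision.zig) := by
    rw [h.mem_upSet hε (by omega) (by omega)]
    obtain ⟨s, hs, hu⟩ := h.existsUnique (r := k) (j := 2 * j + 1)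
      (by simp only [Aztec.IsBlack]; omega)
    have h' (s') : H k (2 * j + 1) s' ↔ s' = s := ⟨hu s', fun e => e ▸ hs⟩
    simp only [h']
    rcases heven (2 * j + 1 + 1) (Finset.mem_Icc.2 ⟨by omega, by omega⟩)
      ⟨j + 1, by omega⟩ with e | e <;> rw [e] <;> cases s <;> simp [Aztec.Decision.sides]
  have hlayouts : {H : ℕ → ℕ → Aztec.Side → Prop | Aztec.IsLayout ε k H ∧
      ∀ j < 2 * k, ∀ s ∈ (d (j + 1)).sides, ¬ H k j s} =
      {H | Aztec.IsLayout ε k H ∧ ∀ j < k, 2 * j + 1 ∈ Aztec.upSet ε k H k ↔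
        d (2 * j + 1 + 1) = Aztec.Decision.zig} := by
    ext H
    refine and_congr_right fun h => ⟨fun hd j hj => (hdecision j hj H h).1 (hd _ (by omega)),
      fun hz j hj => ?_⟩
    rcases Nat.even_or_odd' j with ⟨i, rfl | rfl⟩
    · rw [hodd _ (Finset.mem_Icc.2 ⟨by omega, by omega⟩) ⟨i, rfl⟩]
      simp [Aztec.Decision.sides]
    · exact (hdecision i (by omega) H h).2 (hz i (by omega))
  rw [Aztec.ncard_tilings_eq hn hε d, hlayouts, Aztec.ncard_layouts_eq hε hk0,
    Aztec.card_codes ε k (by omega) hk0, eq_div_iff (by positivity),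
    show (4 : ℚ) = 2 ^ 2 by norm_num, ← pow_mul, ← pow_mul]
  obtain ⟨l, rfl⟩ : ∃ l, k = l + 1 := ⟨k - 1, by omega⟩
  -- Comparison of exponents of `2`, with `n = 2k - 1` for `ε = 0` and `n = 2k` for `ε = 1`.
  interval_cases ε
  · obtain rfl : n = 2 * l + 1 := by omega
    rw [if_neg zero_ne_one, one_mul, ← pow_add, show (2 * l + 1) * (2 * l + 1 + 1) =
      2 * (2 * ((l + 1) * (l + 1 - 1)) + (l + 1)) by simp only [Nat.add_sub_cancel]; ring,
      Nat.mul_div_cancel_left _ two_pos]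
  · obtain rfl : n = 2 * (l + 1) := by omega
    rw [if_pos rfl, ← pow_add, ← pow_add, show 2 * (l + 1) * (2 * (l + 1) + 1) =
      2 * (2 * (l + 1) + 2 * ((l + 1) * (l + 1 - 1)) + (l + 1)) by
        simp only [Nat.add_sub_cancel]; ring,
      Nat.mul_div_cancel_left _ two_pos]
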